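/- **Theorem 7.4 (primal–dual Douglas–Rachford algorithm, quadratic case).** Let $\mathcal X,\mathcal U$ be real Hilbert spaces, let $f:\mathcal X\to\mathbb R\cup\{+\infty\}$ and $g:\mathcal U\to\mathbb R\cup\{+\infty\}$ be convex, proper and lower semicontinuous, let $L:\mathcal X\to\mathcal U$ be a bounded linear operator, let $Q$ be a self-adjoint, positive, nonzero, bounded linear operator on $\mathcal X$, let $c\in\mathcal X$, and set $h(x)=\frac12\langle x,Qx\rangle+\langle x,c\rangle$ and $\beta=\|Q\|$. Consider the primal and dual problems $$\min_{x\in\mathcal X}\; f(x)+g(Lx)+h(x)\quad\text{(P)},\qquad \min_{u\in\mathcal U}\; (f+h)^*(-L^*u)+g^*(u)\quad\text{(D)},$$ where $^*$ on a function denotes the convex conjugate, and assume that there is $x\in\mathcal X$ with $0\in\partial f(x)+L^*\partial g(Lx)+Qx+c$. Let $\tau\in(0,2/\beta)$ and $\sigma>0$ be such that $\sigma\tau\|L\|^2<1$, and let $(\rho^{(i)})_{i\in\mathbb N}$ be a sequence in $[0,2]$ with $\sum_{i}\rho^{(i)}(2-\rho^{(i)})=+\infty$. Let $s^{(0)}\in\mathcal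 X$ and $u^{(0)}\in\mathcal U$, let $\mathrm{prox}_\varphi(x)=\operatorname{argmin}_{x'}\{\varphi(x')+\frac12\|x-x'\|^2\}$, and define sequences, for $i=0,1,\dots$, by either one of the following iterations. Form I: $$\begin{aligned} x^{(i+\frac12)}&=\mathrm{prox}_{\tau f}\big(s^{(i)}-\tfrac\tau2Qs^{(i)}-\tau c\big)\\ u^{(i+\frac12)}&=\mathrm{prox}_{\sigma g^*}\big(u^{(i)}+\sigma L(2x^{(i+\frac12)}-s^{(i)}-\tfrac\tau2Q(2x^{(i+\frac12)}-s^{(i)})-\tau L^*u^{(i)})\big)\\ s^{(i+\frac12)}&=x^{(i+\frac12)}-\tfrac\tau2Q(2x^{(i+\frac12)}-s^{(i)})-\tau L^*u^{(i+\frac12)}\\ s^{(i+1)}&=s^{(i)}+\rho^{(i)}(s^{(i+\frac12)}-s^{(i)})\\ u^{(i+1)}&=u^{(i)}+\rho^{(i)}(u^{(i+\frac12)}-u^{(i)}). \end{aligned}$$ Form II: $$\begin{aligned} u^{(i+\frac12)}&=\mathrm{prox}_{\sigma g^*}\big(u^{(i)}+\sigma L(s^{(i)}-\tfrac\tau2Qs^{(i)}-\tau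 L^*u^{(i)})\big)\\ y^{(i+\frac12)}&=s^{(i)}-\tfrac\tau2Qs^{(i)}-\tau L^*u^{(i+\frac12)}\\ x^{(i+\frac12)}&=\mathrm{prox}_{\tau f}\big(2y^{(i+\frac12)}-s^{(i)}-\tfrac\tau2Q(2y^{(i+\frac12)}-s^{(i)})-\tau c\big)\\ s^{(i+1)}&=s^{(i)}+\rho^{(i)}(x^{(i+\frac12)}-y^{(i+\frac12)})\\ u^{(i+1)}&=u^{(i)}+\rho^{(i)}(u^{(i+\frac12)}-u^{(i)}). \end{aligned}$$ Then, for either iteration, $(x^{(i+\frac12)})_i$ converges weakly to a solution of (P) and $(u^{(i)})_i$ converges weakly to a solution of (D). Moreover, the operator $P=\mathrm{diag}\big(\frac1\tau\mathrm{Id}-\frac12Q,\ \frac1\sigma\mathrm{Id}-\tau LL^*\big)$ on $\mathcal Z=\mathcal X\times\mathcal U$ is bounded, self-adjoint and strongly positive ($P-a\,\mathrm{Id}$ is positive for some real $a>0$); let $\mathcal Z_P$ be $\mathcal Z$ with the inner product $\langle z,Pz'\rangle$. The set-valued operators $$M(x,u)=P^{-1}\big(\partial f(x)+\tfrac12Qx+c,\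 0\big),\qquad N(x,u)=P^{-1}\big(\tfrac12Qx+L^*u,\ -Lx+(\partial g)^{-1}u\big)$$ are maximally monotone in $\mathcal Z_P$. With $J_A=(A+\mathrm{Id})^{-1}$ denoting the resolvent, call Douglas–Rachford iteration for a pair $(A,B)$ of set-valued operators on $\mathcal Z$ the iteration $z^{(i+\frac12)}=J_A(r^{(i)})$, $w^{(i+\frac12)}=J_B(2z^{(i+\frac12)}-r^{(i)})$, $r^{(i+1)}=r^{(i)}+\rho^{(i)}(w^{(i+\frac12)}-z^{(i+\frac12)})$. Then Form I is this iteration for $(M,N)$, with $r^{(i)}=(s^{(i)},u^{(i)})$, $z^{(i+\frac12)}=(x^{(i+\frac12)},u^{(i)})$ and $w^{(i+\frac12)}=(x^{(i+\frac12)}+s^{(i+\frac12)}-s^{(i)},\,u^{(i+\frac12)})$; Form II is this iteration for $(N,M)$, with $r^{(i)}=(s^{(i)},u^{(i)})$, $z^{(i+\frac12)}=(y^{(i+\frac12)},u^{(i+\frac12)})$ and $w^{(i+\frac12)}=(x^{(i+\frac12)},\,2u^{(i+\frac12)}-u^{(i)})$. -/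

import Mathlib

open Filter Topology Set
open scoped Pointwise

noncomputable section

namespace PDDR

/-! ### Convex analysis for extended-real-valued functions on a real Hilbert space -/

/-- `f ∈ Γ₀(H)`: convex (its epigraph is convex), proper (never `-∞`, not identically `+∞`) and
lower semicontinuous. -/
structure Gamma0 {H : Type*} [NormedAddCommGroup H] [InnerProductSpace ℝ H]
    (f : H → EReal) : Prop where
  convex_epigraph : Convex ℝ {p : H × ℝ | f p.1 ≤ (p.2 : EReal)}
  ne_bot : ∀ x, f x ≠ ⊥
  exists_ne_top : ∃ x, f x ≠ ⊤
  lsc : LowerSemicontinuous f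

/-- The subdifferential `∂f`. -/
def subdiff {H : Type*} [NormedAddCommGroup H] [InnerProductSpace ℝ H]
    (f : H → EReal) (x : H) : Set H :=
  {u | ∀ y, f x + ((inner ℝ (y - x) u : ℝ) : EReal) ≤ f y}

/-- The inverse of a set-valued operator. -/
def opInv {H : Type*} (A : H → Set H) (u : H) : Set H := {x | u ∈ A x}

/-- The conjugate `f*(u) = sup_x (⟪u, x⟫ - f x)`. -/
def conj {H : Type*} [NormedAddCommGroup H] [InnerProductSpace ℝ H]
    (f : H → EReal) (u : H) : EReal :=
  ⨆ x, ((inner ℝ u x : ℝ) : EReal) - f x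

/-- The positive multiple `γ f` of an extended-real-valued function. -/
def scale {H : Type*} (γ : ℝ) (f : H → EReal) (x : H) : EReal := (γ : EReal) * f x

/-- The proximity operator `prox_f x = argmin_p { f p + ½ ‖x - p‖² }` (for `f ∈ Γ₀(H)` there is
exactly one minimizer; the value is arbitrary if there is none). -/
def prox {H : Type*} [NormedAddCommGroup H] [InnerProductSpace ℝ H]
    (f : H → EReal) (x : H) : H :=
  Classical.epsilon fun p => IsMinOn (fun y => f y + ((1 / 2 * ‖x - y‖ ^ 2 : ℝ) : EReal)) univ p

/-- Weak convergence of a sequence in a real Hilbert space. -/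
def WeakTendsto {H : Type*} [NormedAddCommGroup H] [InnerProductSpace ℝ H]
    (x : ℕ → H) (l : H) : Prop :=
  Tendsto (fun i => toWeakSpace ℝ H (x i)) atTop (𝓝 (toWeakSpace ℝ H l))

/-- The quadratic function `h(x) = ½ ⟪x, Q x⟫ + ⟪x, c⟫`. -/
def quad {X : Type*} [NormedAddCommGroup X] [InnerProductSpace ℝ X]
    (Q : X →L[ℝ] X) (c : X) (x : X) : EReal :=
  ((1 / 2 * inner ℝ x (Q x) + inner ℝ x c : ℝ) : EReal)

/-! ### The optimization problems -/

/-- `x` minimizes `f + g ∘ L + h`. -/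
def IsPrimalSol {X U : Type*} [NormedAddCommGroup X] [InnerProductSpace ℝ X]
    [NormedAddCommGroup U] [InnerProductSpace ℝ U]
    (f : X → EReal) (g : U → EReal) (L : X →L[ℝ] U) (h : X → EReal) (x : X) : Prop :=
  IsMinOn (fun x => f x + g (L x) + h x) univ x

/-- `u` minimizes `(f + h)*(-L* u) + g*(u)`. -/
def IsDualSol {X U : Type*} [NormedAddCommGroup X] [InnerProductSpace ℝ X] [CompleteSpace X]
    [NormedAddCommGroup U] [InnerProductSpace ℝ U] [CompleteSpace U]
    (f : X → EReal) (g : U → EReal) (L : X →L[ℝ] U) (h : X → EReal) (u : U) : Prop :=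
  IsMinOn (fun u => conj (fun x => f x + h x) (-(ContinuousLinearMap.adjoint L u)) + conj g u)
    univ u

/-! ### The two forms of the iteration -/

/-- Form I; `xh i`, `uh i`, `sh i` stand for the iterates with index `i + 1/2`. -/
structure IsFormI {X U : Type*} [NormedAddCommGroup X] [InnerProductSpace ℝ X] [CompleteSpace X]
    [NormedAddCommGroup U] [InnerProductSpace ℝ U] [CompleteSpace U]
    (f : X → EReal) (g : U → EReal) (L : X →L[ℝ] U) (Q : X →L[ℝ] X) (c : X) (τ σ : ℝ)
    (ρ : ℕ → ℝ) (s₀ : X) (u₀ : U)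
    (xh : ℕ → X) (uh : ℕ → U) (sh s : ℕ → X) (u : ℕ → U) : Prop where
  s_zero : s 0 = s₀
  u_zero : u 0 = u₀
  xh_eq : ∀ i, xh i = prox (scale τ f) (s i - (τ / 2) • Q (s i) - τ • c)
  uh_eq : ∀ i, uh i = prox (scale σ (conj g))
    (u i + σ • L ((2 : ℝ) • xh i - s i - (τ / 2) • Q ((2 : ℝ) • xh i - s i)
      - τ • ContinuousLinearMap.adjoint L (u i)))
  sh_eq : ∀ i, sh i = xh i - (τ / 2) • Q ((2 : ℝ) • xh i - s i)
    - τ • ContinuousLinearMap.adjoint L (uh i)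
  s_succ : ∀ i, s (i + 1) = s i + ρ i • (sh i - s i)
  u_succ : ∀ i, u (i + 1) = u i + ρ i • (uh i - u i)

/-- Form II; `uh i`, `yh i`, `xh i` stand for the iterates with index `i + 1/2`. -/
structure IsFormII {X U : Type*} [NormedAddCommGroup X] [InnerProductSpace ℝ X] [CompleteSpace X]
    [NormedAddCommGroup U] [InnerProductSpace ℝ U] [CompleteSpace U]
    (f : X → EReal) (g : U → EReal) (L : X →L[ℝ] U) (Q : X →L[ℝ] X) (c : X) (τ σ : ℝ)
    (ρ : ℕ → ℝ) (s₀ : X) (u₀ : U)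
    (uh : ℕ → U) (yh xh s : ℕ → X) (u : ℕ → U) : Prop where
  s_zero : s 0 = s₀
  u_zero : u 0 = u₀
  uh_eq : ∀ i, uh i = prox (scale σ (conj g))
    (u i + σ • L (s i - (τ / 2) • Q (s i) - τ • ContinuousLinearMap.adjoint L (u i)))
  yh_eq : ∀ i, yh i = s i - (τ / 2) • Q (s i) - τ • ContinuousLinearMap.adjoint L (uh i)
  xh_eq : ∀ i, xh i = prox (scale τ f)
    ((2 : ℝ) • yh i - s i - (τ / 2) • Q ((2 : ℝ) • yh i - s i) - τ • c)
  s_succ : ∀ i, s (i + 1) = s i + ρ i • (xh i - yh i)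
  u_succ : ∀ i, u (i + 1) = u i + ρ i • (uh i - u i)

/-! ### Monotone operators and the Douglas–Rachford iteration -/

/-- Strongly positive bounded operator: `P - a Id` is positive for some `a > 0`. -/
def StronglyPositive {Z : Type*} [NormedAddCommGroup Z] [InnerProductSpace ℝ Z]
    (P : Z →L[ℝ] Z) : Prop :=
  ∃ a : ℝ, 0 < a ∧ (P - a • ContinuousLinearMap.id ℝ Z).IsPositive

/-- Monotonicity with respect to the inner product `⟪z, z'⟫_P = ⟪z, P z'⟫`. -/
def MonotoneIn {Z : Type*} [NormedAddCommGroup Z] [InnerProductSpace ℝ Z]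
    (P : Z →L[ℝ] Z) (A : Z → Set Z) : Prop :=
  ∀ z z', ∀ v ∈ A z, ∀ v' ∈ A z', 0 ≤ inner ℝ (z - z') (P (v - v'))

/-- Maximal monotonicity with respect to `⟪·, ·⟫_P`. -/
def MaxMonotoneIn {Z : Type*} [NormedAddCommGroup Z] [InnerProductSpace ℝ Z]
    (P : Z →L[ℝ] Z) (A : Z → Set Z) : Prop :=
  MonotoneIn P A ∧ ∀ B : Z → Set Z, MonotoneIn P B → (∀ z, A z ⊆ B z) → B = A

/-- The resolvent `J_A = (A + Id)⁻¹`, as a set-valued operator. -/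
def resolvent {Z : Type*} [NormedAddCommGroup Z] (A : Z → Set Z) : Z → Set Z :=
  opInv fun z => A z + {z}

/-- The relaxed Douglas–Rachford iteration for `0 ∈ A z + B z` with unit stepsize:
`z = J_A s`, `w = J_B (2 z - s)`, `s⁺ = s + ρ (w - z)`, the resolvents being single-valued at the
points where they are evaluated. -/
structure IsDouglasRachford {Z : Type*} [NormedAddCommGroup Z] [InnerProductSpace ℝ Z]
    (A B : Z → Set Z) (ρ : ℕ → ℝ) (s z w : ℕ → Z) : Prop where
  z_eq : ∀ i, resolvent A (s i) = {z i}
  w_eq : ∀ i, resolvent B ((2 : ℝ) • z i - s i) = {w i}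
  s_succ : ∀ i, s (i + 1) = s i + ρ i • (w i - z i)

/-- The preconditioner `P = diag((1/τ) Id - ½ Q, (1/σ) Id - τ L L*)` on the Hilbert product
`X × U`. -/
def precond {X U : Type*} [NormedAddCommGroup X] [InnerProductSpace ℝ X] [CompleteSpace X]
    [NormedAddCommGroup U] [InnerProductSpace ℝ U] [CompleteSpace U]
    (L : X →L[ℝ] U) (Q : X →L[ℝ] X) (τ σ : ℝ) : WithLp 2 (X × U) →L[ℝ] WithLp 2 (X × U) :=
  ((WithLp.prodContinuousLinearEquiv 2 ℝ X U).symm : X × U →L[ℝ] WithLp 2 (X × U)) ∘L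
    (((1 / τ) • ContinuousLinearMap.id ℝ X - (1 / 2 : ℝ) • Q).prodMap
      ((1 / σ) • ContinuousLinearMap.id ℝ U - τ • (L ∘L ContinuousLinearMap.adjoint L))) ∘L
    (WithLp.prodContinuousLinearEquiv 2 ℝ X U : WithLp 2 (X × U) →L[ℝ] X × U)

/-- `M (x, u) = P⁻¹ (∂f(x) + ½ Q x + c, 0)`; `P⁻¹` is written as a preimage under `P`. -/
def opM {X U : Type*} [NormedAddCommGroup X] [InnerProductSpace ℝ X] [CompleteSpace X]
    [NormedAddCommGroup U] [InnerProductSpace ℝ U] [CompleteSpace U]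
    (f : X → EReal) (L : X →L[ℝ] U) (Q : X →L[ℝ] X) (c : X) (τ σ : ℝ)
    (z : WithLp 2 (X × U)) : Set (WithLp 2 (X × U)) :=
  precond L Q τ σ ⁻¹'
    {v | v.fst ∈ subdiff f z.fst + {(1 / 2 : ℝ) • Q z.fst + c} ∧ v.snd = 0}

/-- `N (x, u) = P⁻¹ (½ Q x + L* u, -L x + (∂g)⁻¹ u)`; `P⁻¹` is written as a preimage under
`P`. -/
def opN {X U : Type*} [NormedAddCommGroup X] [InnerProductSpace ℝ X] [CompleteSpace X]
    [NormedAddCommGroup U] [InnerProductSpace ℝ U] [CompleteSpace U]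
    (g : U → EReal) (L : X →L[ℝ] U) (Q : X →L[ℝ] X) (τ σ : ℝ)
    (z : WithLp 2 (X × U)) : Set (WithLp 2 (X × U)) :=
  precond L Q τ σ ⁻¹'
    {v | v.fst = (1 / 2 : ℝ) • Q z.fst + ContinuousLinearMap.adjoint L z.snd ∧
      v.snd ∈ {-(L z.fst)} + opInv (subdiff g) z.snd}

end PDDR

end

/-!
Either form of the iteration is the relaxed Douglas–Rachford iteration for `M` and `N` in the
Hilbert space `Z_P`: the inclusions `r - z ∈ M z` and `r - z ∈ N z` decouple, because `P`
contributes exactly the terms that make the first one a proximal step of `τ f` and the second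
one, after elimination of the primal variable, a proximal step of `σ g*`. The zeros of `M + N`
are the primal–dual pairs satisfying the optimality conditions, and at such a pair `0` is a
subgradient both of the primal and of the dual objective.

The Douglas–Rachford map `r ↦ r + (w - z)` is firmly nonexpansive in `Z_P`. Hence its relaxed
iterates are Fejér monotone and the residuals `w - z` decrease; as the squared residuals are
summable with the non-summable weights `ρ (2 - ρ)`, they tend to `0`. The iterates themselves
(and not only the sequence `r`) then converge weakly, by maximal monotonicity applied to a weak
cluster point of the pair `(r, z)` together with Opial's lemma.
-/

namespace PDDR

open ContinuousLinearMap (adjoint)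

section ProximityOperator

variable {H : Type*}

/-- The part of the epigraph of an extended-real-valued function lying over the real numbers. -/
def epigraph (f : H → EReal) : Set (H × ℝ) :=
  {p | f p.1 ≤ (p.2 : EReal)}

theorem mem_epigraph_add_coe {f : H → EReal} {φ : H → ℝ} {p : H × ℝ} :
    p ∈ epigraph (fun y => f y + (φ y : EReal)) ↔ (p.1, p.2 - φ p.1) ∈ epigraph f := by
  change f p.1 + (φ p.1 : EReal) ≤ p.2 ↔ f p.1 ≤ ((p.2 - φ p.1 : ℝ) : EReal)
  rw [EReal.coe_sub, EReal.le_sub_iff_add_le (.inl (EReal.coe_ne_bot _))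
    (.inl (EReal.coe_ne_top _))]

theorem le_of_forall_mem_epigraph {f : H → EReal} {a : EReal} {y : H}
    (h : ∀ t : ℝ, (y, t) ∈ epigraph f → a ≤ t) : a ≤ f y :=
  EReal.le_of_forall_lt_iff_le.1 fun t ht => h t ht.le

theorem exists_isMinOn_snd_of_midpoint {α : Type*} [PseudoMetricSpace α] [CompleteSpace α]
    {S : Set (α × ℝ)} (hS : IsClosed S) (hne : S.Nonempty) (hbdd : BddBelow (Prod.snd '' S))
    {κ : ℝ} (hκ : 0 < κ)
    (hmid : ∀ p ∈ S, ∀ q ∈ S, ∃ r ∈ S, r.2 + κ * dist p.1 q.1 ^ 2 ≤ (p.2 + q.2) / 2) :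
    ∃ p ∈ S, IsMinOn Prod.snd S p := by
  obtain ⟨t, ht_anti, ht_lim, ht_mem⟩ := exists_seq_tendsto_sInf (hne.image Prod.snd) hbdd
  set m := sInf (Prod.snd '' S)
  have hm : ∀ p ∈ S, m ≤ p.2 := fun p hp => csInf_le hbdd (mem_image_of_mem _ hp)
  choose q hqS hqt using ht_mem
  have hdist : ∀ n k, n ≤ k → dist (q n).1 (q k).1 ≤ √(κ⁻¹ * (t n - m)) := fun n k hnk => by
    obtain ⟨r, hrS, hr⟩ := hmid _ (hqS n) _ (hqS k)
    refine Real.le_sqrt_of_sq_le ((le_inv_mul_iff₀ hκ).2 ?_)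
    linarith [hm r hrS, ht_anti hnk, hqt n, hqt k]
  have hdist_lim : Tendsto (fun n => √(κ⁻¹ * (t n - m))) atTop (𝓝 0) := by
    simpa using ((ht_lim.sub_const m).const_mul κ⁻¹).sqrt
  obtain ⟨x, hx⟩ := cauchySeq_tendsto_of_complete (cauchySeq_of_le_tendsto_0' _ hdist hdist_lim)
  have hqlim : Tendsto q atTop (𝓝 (x, m)) := hx.prodMk_nhds (by simpa only [hqt] using ht_lim)
  exact ⟨(x, m), hS.mem_of_tendsto hqlim (.of_forall hqS), hm⟩

variable [NormedAddCommGroup H] {f : H → EReal}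

/-- `p` minimizes `f + ½ ‖w - ·‖²`, i.e. it is a value of the proximity operator of `f` at `w`. -/
def IsProx (f : H → EReal) (w p : H) : Prop :=
  IsMinOn (fun y => f y + ((1 / 2 * ‖w - y‖ ^ 2 : ℝ) : EReal)) univ p

theorem IsProx.le {w p : H} (h : IsProx f w p) (y : H) :
    f p + ((1 / 2 * ‖w - p‖ ^ 2 : ℝ) : EReal) ≤ f y + ((1 / 2 * ‖w - y‖ ^ 2 : ℝ) : EReal) :=
  h (mem_univ y)

variable [InnerProductSpace ℝ H]

theorem Gamma0.isClosed_epigraph (hf : Gamma0 f) : IsClosed (epigraph f) :=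
  hf.lsc.isClosed_epigraph.preimage
    (continuous_fst.prodMk (continuous_coe_real_ereal.comp continuous_snd))

theorem Gamma0.exists_eq_coe (hf : Gamma0 f) : ∃ (x : H) (t : ℝ), f x = t :=
  hf.exists_ne_top.imp fun x hx => ⟨(f x).toReal, (EReal.coe_toReal hx (hf.ne_bot x)).symm⟩

theorem Gamma0.exists_affine_minorant (hf : Gamma0 f) :
    ∃ (a : H →L[ℝ] ℝ) (b : ℝ), ∀ y, ((a y + b : ℝ) : EReal) ≤ f y := by
  obtain ⟨x, t, hx⟩ := hf.exists_eq_coe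
  have hnot_mem : (x, t - 1) ∉ epigraph f := fun h => by
    have : (t : EReal) ≤ (t - 1 : ℝ) := hx ▸ h
    linarith [EReal.coe_le_coe_iff.1 this]
  obtain ⟨l, s, hs, hl⟩ :=
    geometric_hahn_banach_point_closed hf.convex_epigraph hf.isClosed_epigraph hnot_mem
  have hl_split : ∀ (y : H) (r : ℝ), l (y, r) = l (y, 0) + r * l (0, 1) := fun y r => by
    rw [← smul_eq_mul, ← map_smul, ← map_add]
    simp
  have hl_pos : 0 < l (0, 1) := by
    have := hl (x, t) hx.le
    rw [hl_split] at hs this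
    linarith
  refine ⟨-((l (0, 1))⁻¹ • l.comp (ContinuousLinearMap.inl ℝ H ℝ)), (l (0, 1))⁻¹ * s,
    fun y => le_of_forall_mem_epigraph fun r hr => EReal.coe_le_coe_iff.2 ?_⟩
  have hsep := hl (y, r) hr
  rw [hl_split] at hsep
  have : (l (0, 1))⁻¹ * (s - l (y, 0)) ≤ r := (inv_mul_le_iff₀ hl_pos).2 (by linarith)
  simp only [neg_apply, smul_apply, ContinuousLinearMap.comp_apply,
    ContinuousLinearMap.inl_apply, smul_eq_mul]
  linarith

theorem Gamma0.bddBelow_add_half_norm_sq (hf : Gamma0 f) (w : H) :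
    BddBelow (Prod.snd '' epigraph fun y => f y + ((1 / 2 * ‖w - y‖ ^ 2 : ℝ) : EReal)) := by
  obtain ⟨a, b, hab⟩ := hf.exists_affine_minorant
  refine ⟨a w + b - 1 / 2 * ‖a‖ ^ 2, ?_⟩
  rintro _ ⟨⟨y, t⟩, hyt, rfl⟩
  have hy : a y + b ≤ t - 1 / 2 * ‖w - y‖ ^ 2 :=
    EReal.coe_le_coe_iff.1 ((hab y).trans (mem_epigraph_add_coe.1 hyt))
  have hwy : a w - a y ≤ ‖a‖ * ‖w - y‖ := by
    rw [← map_sub]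
    exact (le_abs_self _).trans (a.le_opNorm _)
  change a w + b - 1 / 2 * ‖a‖ ^ 2 ≤ t
  linarith [two_mul_le_add_sq ‖a‖ ‖w - y‖]

theorem half_norm_sq_midpoint (w p q : H) :
    1 / 2 * ‖w - ((1 / 2 : ℝ) • p + (1 / 2 : ℝ) • q)‖ ^ 2 + 1 / 8 * dist p q ^ 2
      = (1 / 2 * ‖w - p‖ ^ 2 + 1 / 2 * ‖w - q‖ ^ 2) / 2 := by
  have hmid : w - ((1 / 2 : ℝ) • p + (1 / 2 : ℝ) • q)
      = (1 / 2 : ℝ) • ((w - q) + (w - p)) := by module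
  have hdiff : p - q = (w - q) - (w - p) := by abel
  rw [hmid, norm_smul, dist_eq_norm, hdiff, Real.norm_of_nonneg one_half_pos.le]
  linarith [parallelogram_law_with_norm ℝ (w - q) (w - p)]

theorem Gamma0.exists_isProx [CompleteSpace H] (hf : Gamma0 f) (w : H) : ∃ p, IsProx f w p := by
  set S := epigraph fun y => f y + ((1 / 2 * ‖w - y‖ ^ 2 : ℝ) : EReal)
  have hS : IsClosed S := by
    have : S = (fun p => (p.1, p.2 - 1 / 2 * ‖w - p.1‖ ^ 2)) ⁻¹' epigraph f :=
      Set.ext fun _ => mem_epigraph_add_coe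
    exact this ▸ hf.isClosed_epigraph.preimage (by fun_prop)
  have hne : S.Nonempty := by
    obtain ⟨x, t, hx⟩ := hf.exists_eq_coe
    exact ⟨(x, t + 1 / 2 * ‖w - x‖ ^ 2), mem_epigraph_add_coe.2 (by simp [epigraph, hx])⟩
  have hmid : ∀ p ∈ S, ∀ q ∈ S,
      ∃ r ∈ S, r.2 + 1 / 8 * dist p.1 q.1 ^ 2 ≤ (p.2 + q.2) / 2 := fun p hp q hq => by
    have h := hf.convex_epigraph (mem_epigraph_add_coe.1 hp) (mem_epigraph_add_coe.1 hq)
      one_half_pos.le one_half_pos.le (add_halves 1)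
    set r := (1 / 2 : ℝ) • p.1 + (1 / 2 : ℝ) • q.1
    refine ⟨(r, (p.2 + q.2) / 2 - 1 / 8 * dist p.1 q.1 ^ 2), mem_epigraph_add_coe.2 ?_, by simp⟩
    convert! h using 2
    simp only [Prod.snd_add, Prod.smul_snd, smul_eq_mul]
    linarith [half_norm_sq_midpoint w p.1 q.1]
  obtain ⟨⟨p, r⟩, hp, hmin⟩ :=
    exists_isMinOn_snd_of_midpoint hS hne (hf.bddBelow_add_half_norm_sq w) (by norm_num) hmid
  refine ⟨p, fun y _ => le_of_forall_mem_epigraph fun t ht => ?_⟩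
  exact (show _ ≤ (r : EReal) from hp).trans (EReal.coe_le_coe_iff.2 (isMinOn_iff.1 hmin (y, t) ht))

theorem le_of_forall_Ioo_le_add_mul {a b c : ℝ} (h : ∀ s ∈ Ioo (0 : ℝ) 1, a ≤ b + s * c) :
    a ≤ b := by
  have hlim : Tendsto (fun s : ℝ => b + s * c) (𝓝[>] 0) (𝓝 (b + 0 * c)) :=
    ((continuous_id.mul continuous_const).const_add b).continuousWithinAt
  rw [zero_mul, add_zero] at hlim
  exact ge_of_tendsto hlim (eventually_of_mem (Ioo_mem_nhdsGT one_pos) h)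

theorem IsProx.exists_eq_coe (hf : Gamma0 f) {w p : H} (h : IsProx f w p) :
    ∃ t : ℝ, f p = t := by
  obtain ⟨x, t, hx⟩ := hf.exists_eq_coe
  have hle := h.le x
  refine ⟨(f p).toReal, (EReal.coe_toReal (fun htop => ?_) (hf.ne_bot p)).symm⟩
  rw [htop, hx, EReal.top_add_coe, ← EReal.coe_add, top_le_iff] at hle
  exact EReal.coe_ne_top _ hle

theorem IsProx.sub_mem_subdiff (hf : Gamma0 f) {w p : H} (h : IsProx f w p) :
    w - p ∈ subdiff f p := by
  obtain ⟨r, hr⟩ := h.exists_eq_coe hf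
  refine fun y => le_of_forall_mem_epigraph fun t ht => ?_
  rw [hr, ← EReal.coe_add, EReal.coe_le_coe_iff]
  -- compare `p` with the points `(1 - s) p + s y` of the segment towards `y`, and let `s → 0`
  refine le_of_forall_Ioo_le_add_mul (c := 1 / 2 * ‖y - p‖ ^ 2) fun s ⟨hs₀, hs₁⟩ => ?_
  have hconv : f ((1 - s) • p + s • y) ≤ (((1 - s) * r + s * t : ℝ) : EReal) :=
    hf.convex_epigraph (show (p, r) ∈ epigraph f from hr.le) ht (by linarith) hs₀.le (by ring)
  have hmin : r + 1 / 2 * ‖w - p‖ ^ 2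
      ≤ (1 - s) * r + s * t + 1 / 2 * ‖w - ((1 - s) • p + s • y)‖ ^ 2 := by
    rw [← EReal.coe_le_coe_iff, EReal.coe_add, EReal.coe_add, ← hr]
    exact (h.le _).trans (add_le_add_left hconv _)
  have hsegment : w - ((1 - s) • p + s • y) = (w - p) - s • (y - p) := by module
  rw [hsegment, norm_sub_sq_real (w - p), norm_smul, real_inner_smul_right,
    Real.norm_of_nonneg hs₀.le, real_inner_comm] at hmin
  exact le_of_mul_le_mul_left (by linarith) hs₀

theorem half_norm_sub_sq (w p y : H) :
    1 / 2 * ‖w - y‖ ^ 2 = 1 / 2 * ‖w - p‖ ^ 2 - inner ℝ (y - p) (w - p) + 1 / 2 * ‖y - p‖ ^ 2 := by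
  rw [← sub_sub_sub_cancel_right w y p, norm_sub_sq_real, real_inner_comm]
  ring

theorem add_half_norm_sq_le_of_sub_mem_subdiff {w p : H} (h : w - p ∈ subdiff f p) (y : H) :
    f p + ((1 / 2 * ‖w - p‖ ^ 2 + 1 / 2 * ‖y - p‖ ^ 2 : ℝ) : EReal)
      ≤ f y + ((1 / 2 * ‖w - y‖ ^ 2 : ℝ) : EReal) := by
  have hsplit : 1 / 2 * ‖w - p‖ ^ 2 + 1 / 2 * ‖y - p‖ ^ 2
      = inner ℝ (y - p) (w - p) + 1 / 2 * ‖w - y‖ ^ 2 := by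
    linarith [half_norm_sub_sq w p y]
  rw [hsplit, EReal.coe_add, ← add_assoc]
  exact add_le_add_left (h y) _

theorem IsProx.of_sub_mem_subdiff {w p : H} (h : w - p ∈ subdiff f p) : IsProx f w p := fun y _ =>
  (add_le_add_right (EReal.coe_le_coe_iff.2 (le_add_of_nonneg_right (by positivity))) _).trans
    (add_half_norm_sq_le_of_sub_mem_subdiff h y)

theorem IsProx.eq_of_sub_mem_subdiff {w p q : H} {t : ℝ} (ht : f p = t) (hq : IsProx f w q)
    (hp : w - p ∈ subdiff f p) : q = p := by
  have hle := (add_half_norm_sq_le_of_sub_mem_subdiff hp q).trans (hq.le p)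
  rw [ht, ← EReal.coe_add, ← EReal.coe_add, EReal.coe_le_coe_iff] at hle
  have hnorm : ‖q - p‖ ^ 2 ≤ 0 := by linarith
  simpa [sub_eq_zero] using hnorm

theorem prox_eq_of_sub_mem_subdiff {w p : H} {t : ℝ} (ht : f p = t) (h : w - p ∈ subdiff f p) :
    prox f w = p :=
  (Classical.epsilon_spec (p := IsProx f w) ⟨p, .of_sub_mem_subdiff h⟩).eq_of_sub_mem_subdiff ht h

theorem Gamma0.isProx_prox [CompleteSpace H] (hf : Gamma0 f) (w : H) : IsProx f w (prox f w) :=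
  Classical.epsilon_spec (hf.exists_isProx w)

end ProximityOperator

section SubdifferentialCalculus

variable {H K : Type*} [NormedAddCommGroup H] [InnerProductSpace ℝ H]
  [NormedAddCommGroup K] [InnerProductSpace ℝ K] {f : H → EReal}

theorem Gamma0.exists_eq_coe_of_mem_subdiff (hf : Gamma0 f) {x u : H} (h : u ∈ subdiff f x) :
    ∃ t : ℝ, f x = t := by
  obtain ⟨y, r, hy⟩ := hf.exists_eq_coe
  refine ⟨(f x).toReal, (EReal.coe_toReal (fun htop => ?_) (hf.ne_bot x)).symm⟩
  have hle := h y
  rw [htop, hy, EReal.top_add_coe, top_le_iff] at hle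
  exact EReal.coe_ne_top _ hle

theorem Gamma0.inner_sub_nonneg (hf : Gamma0 f) {x y u v : H} (hu : u ∈ subdiff f x)
    (hv : v ∈ subdiff f y) : 0 ≤ inner ℝ (x - y) (u - v) := by
  obtain ⟨s, hs⟩ := hf.exists_eq_coe_of_mem_subdiff hu
  obtain ⟨t, ht⟩ := hf.exists_eq_coe_of_mem_subdiff hv
  have hxy := hu y
  have hyx := hv x
  rw [hs, ht, ← EReal.coe_add, EReal.coe_le_coe_iff] at hxy hyx
  rw [← neg_sub x y, inner_neg_left] at hxy
  rw [inner_sub_right]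
  linarith

theorem isMinOn_of_zero_mem_subdiff {x : H} (h : (0 : H) ∈ subdiff f x) : IsMinOn f univ x :=
  fun y _ => by simpa using h y

theorem add_mem_subdiff_add {g : H → EReal} {x u v : H} (hu : u ∈ subdiff f x)
    (hv : v ∈ subdiff g x) : u + v ∈ subdiff (fun x => f x + g x) x := fun y => by
  rw [inner_add_right, EReal.coe_add, add_add_add_comm]
  exact add_le_add (hu y) (hv y)

theorem adjoint_mem_subdiff_comp [CompleteSpace H] [CompleteSpace K] {g : K → EReal}
    (T : H →L[ℝ] K) {x : H} {v : K} (hv : v ∈ subdiff g (T x)) :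
    adjoint T v ∈ subdiff (fun x => g (T x)) x := fun y => by
  rw [ContinuousLinearMap.adjoint_inner_right, map_sub]
  exact hv (T y)

theorem gradient_mem_subdiff_quad {Q : H →L[ℝ] H} (hQ : Q.IsPositive) (c x : H) :
    Q x + c ∈ subdiff (quad Q c) x := fun y => by
  have hpos := hQ.inner_nonneg_right (y - x)
  have hsymm : inner ℝ x (Q y) = inner ℝ y (Q x) :=
    (real_inner_comm _ _).trans (hQ.isSymmetric y x)
  simp only [quad, ← EReal.coe_add, EReal.coe_le_coe_iff, map_sub, inner_sub_left,
    inner_sub_right, inner_add_right, hsymm] at hpos ⊢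
  linarith

theorem coe_inner_sub_le_conj (f : H → EReal) (u x : H) :
    ((inner ℝ u x : ℝ) : EReal) - f x ≤ conj f u :=
  le_iSup (fun x => ((inner ℝ u x : ℝ) : EReal) - f x) x

theorem conj_eq_of_mem_subdiff {x u : H} (h : u ∈ subdiff f x) :
    conj f u = ((inner ℝ u x : ℝ) : EReal) - f x := by
  refine le_antisymm (iSup_le fun y => ?_) (coe_inner_sub_le_conj f u x)
  have hsplit : (inner ℝ u y : ℝ) = inner ℝ u x + inner ℝ (y - x) u := by
    rw [inner_sub_left, real_inner_comm u y, real_inner_comm u x, add_sub_cancel]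
  calc ((inner ℝ u y : ℝ) : EReal) - f y
      ≤ (inner ℝ u y : ℝ) - (f x + (inner ℝ (y - x) u : ℝ)) := EReal.sub_le_sub le_rfl (h y)
    _ = (inner ℝ u x : ℝ) - f x := by
      rw [hsplit]
      induction f x <;> simp [← EReal.coe_add, ← EReal.coe_sub]

theorem mem_subdiff_conj {x u : H} (h : u ∈ subdiff f x) : x ∈ subdiff (conj f) u := fun v => by
  rw [conj_eq_of_mem_subdiff h, sub_eq_add_neg, add_right_comm, ← EReal.coe_add, inner_sub_left,
    add_sub_cancel, ← sub_eq_add_neg]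
  exact coe_inner_sub_le_conj f v x

theorem smul_mem_subdiff_scale {γ : ℝ} (hγ : 0 ≤ γ) {x u : H} (h : u ∈ subdiff f x) :
    γ • u ∈ subdiff (scale γ f) x := fun y => by
  have hγ' : (0 : EReal) ≤ γ := EReal.coe_nonneg.2 hγ
  rw [scale, scale, real_inner_smul_right, EReal.coe_mul,
    ← EReal.left_distrib_of_nonneg_of_ne_top hγ' (EReal.coe_ne_top γ)]
  exact mul_le_mul_of_nonneg_left (h y) hγ'

theorem inv_scale_scale {E : Type*} (φ : E → EReal) {γ : ℝ} (hγ : γ ≠ 0) :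
    scale γ⁻¹ (scale γ φ) = φ := by
  funext x
  rw [scale, scale, ← mul_assoc, ← EReal.coe_mul, inv_mul_cancel₀ hγ, EReal.coe_one, one_mul]

theorem mem_subdiff_scale_iff {γ : ℝ} (hγ : 0 < γ) {x u : H} :
    u ∈ subdiff (scale γ f) x ↔ γ⁻¹ • u ∈ subdiff f x := by
  refine ⟨fun h => ?_, fun h => ?_⟩
  · exact inv_scale_scale f hγ.ne' ▸ smul_mem_subdiff_scale (inv_nonneg.2 hγ.le) h
  · exact smul_inv_smul₀ hγ.ne' u ▸ smul_mem_subdiff_scale hγ.le h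

theorem Gamma0.pos_scale (hf : Gamma0 f) {γ : ℝ} (hγ : 0 < γ) : Gamma0 (scale γ f) where
  convex_epigraph := by
    have hγ' : (0 : EReal) < γ := EReal.coe_pos.2 hγ
    have hpre : {p : H × ℝ | scale γ f p.1 ≤ p.2}
        = (LinearMap.id.prodMap (γ⁻¹ • LinearMap.id) : H × ℝ →ₗ[ℝ] H × ℝ) ⁻¹'
          {p : H × ℝ | f p.1 ≤ p.2} := by
      ext ⟨x, t⟩
      change γ * f x ≤ t ↔ f x ≤ ((γ⁻¹ * t : ℝ) : EReal)
      rw [mul_comm, ← EReal.le_div_iff_mul_le hγ' (EReal.coe_ne_top γ), ← EReal.coe_div,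
        div_eq_inv_mul]
    exact hpre ▸ hf.convex_epigraph.linear_preimage _
  ne_bot x := by simp [scale, EReal.mul_eq_bot, hf.ne_bot x, hγ.le]
  exists_ne_top := by
    obtain ⟨x, t, hx⟩ := hf.exists_eq_coe
    exact ⟨x, by rw [scale, hx, ← EReal.coe_mul]; exact EReal.coe_ne_top _⟩
  lsc := by
    have hcont : Continuous fun y : EReal => (γ : EReal) * y := continuous_iff_continuousAt.2
      fun y => (EReal.continuousAt_mul (p := (γ, y)) (.inl (by simpa using hγ.ne'))
        (.inl (by simpa using hγ.ne')) (.inl (EReal.coe_ne_bot γ))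
        (.inl (EReal.coe_ne_top γ))).comp (continuous_const.prodMk continuous_id).continuousAt
    exact hcont.comp_lowerSemicontinuous hf.lsc
      fun _ _ h => mul_le_mul_of_nonneg_left h (EReal.coe_nonneg.2 hγ.le)

theorem Gamma0.prox_scale_eq_iff [CompleteSpace H] (hf : Gamma0 f) {γ : ℝ} (hγ : 0 < γ)
    {w p : H} : prox (scale γ f) w = p ↔ γ⁻¹ • (w - p) ∈ subdiff f p := by
  have hγf := hf.pos_scale hγ
  rw [← mem_subdiff_scale_iff hγ]
  refine ⟨?_, fun h => ?_⟩
  · rintro rfl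
    exact (hγf.isProx_prox w).sub_mem_subdiff hγf
  · obtain ⟨t, ht⟩ := hγf.exists_eq_coe_of_mem_subdiff h
    exact prox_eq_of_sub_mem_subdiff ht h

theorem Gamma0.prox_scale_conj_eq_of_mem_subdiff (hf : Gamma0 f) {γ : ℝ} (hγ : 0 < γ) {w p : H}
    (h : p ∈ subdiff f (γ⁻¹ • (w - p))) : prox (scale γ (conj f)) w = p := by
  obtain ⟨t, ht⟩ := hf.exists_eq_coe_of_mem_subdiff h
  have hfinite : scale γ (conj f) p = ((γ * (inner ℝ p (γ⁻¹ • (w - p)) - t) : ℝ) : EReal) := by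
    rw [scale, conj_eq_of_mem_subdiff h, ht, ← EReal.coe_sub, ← EReal.coe_mul]
  exact prox_eq_of_sub_mem_subdiff hfinite ((mem_subdiff_scale_iff hγ).2 (mem_subdiff_conj h))

theorem Gamma0.prox_scale_conj_eq_iff [CompleteSpace H] (hf : Gamma0 f) {γ : ℝ} (hγ : 0 < γ)
    {w p : H} : prox (scale γ (conj f)) w = p ↔ p ∈ subdiff f (γ⁻¹ • (w - p)) := by
  refine ⟨?_, hf.prox_scale_conj_eq_of_mem_subdiff hγ⟩
  rintro rfl
  -- Moreau's decomposition `prox_{γ f*} w + γ prox_{f / γ} (w / γ) = w`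
  set q := prox (scale γ⁻¹ f) (γ⁻¹ • w) with hq
  have hq_eq : γ⁻¹ • (w - (w - γ • q)) = q := by rw [sub_sub_cancel, inv_smul_smul₀ hγ.ne']
  have hmem : w - γ • q ∈ subdiff f (γ⁻¹ • (w - (w - γ • q))) := by
    simpa only [hq_eq, inv_inv, smul_sub, smul_inv_smul₀ hγ.ne']
      using (hf.prox_scale_eq_iff (inv_pos.2 hγ)).1 hq.symm
  rwa [hf.prox_scale_conj_eq_of_mem_subdiff hγ hmem]

end SubdifferentialCalculus

section OptimalityConditions

variable {X U : Type*} [NormedAddCommGroup X] [InnerProductSpace ℝ X] [CompleteSpace X]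
  [NormedAddCommGroup U] [InnerProductSpace ℝ U] [CompleteSpace U]
  {f : X → EReal} {g : U → EReal} {L : X →L[ℝ] U} {h : X → EReal} {η x : X} {v : U}

/-- The primal–dual optimality conditions `0 ∈ ∂f(x) + L* v + η`, `v ∈ ∂g(L x)`, where `η` stands
for a subgradient of `h` at `x`. -/
def IsKKT (f : X → EReal) (g : U → EReal) (L : X →L[ℝ] U) (η x : X) (v : U) : Prop :=
  -(η + adjoint L v) ∈ subdiff f x ∧ v ∈ subdiff g (L x)

theorem exists_isKKT
    (hx : (0 : X) ∈ subdiff f x + adjoint L '' subdiff g (L x) + {η}) :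
    ∃ v, IsKKT f g L η x v := by
  obtain ⟨_, ⟨ξ, hξ, _, ⟨v, hv, rfl⟩, rfl⟩, _, rfl, hsum⟩ := hx
  refine ⟨v, ?_, hv⟩
  rwa [add_comm, ← eq_neg_of_add_eq_zero_left ((add_assoc ξ _ _).symm.trans hsum)]

theorem IsKKT.isPrimalSol (hη : η ∈ subdiff h x) (hxv : IsKKT f g L η x v) :
    IsPrimalSol f g L h x := by
  refine isMinOn_of_zero_mem_subdiff ?_
  have hsum := add_mem_subdiff_add
    (add_mem_subdiff_add hxv.1 (adjoint_mem_subdiff_comp L hxv.2)) hη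
  rwa [neg_add, neg_add_cancel_right, neg_add_cancel] at hsum

theorem IsKKT.isDualSol (hη : η ∈ subdiff h x) (hxv : IsKKT f g L η x v) :
    IsDualSol f g L h v := by
  refine isMinOn_of_zero_mem_subdiff ?_
  have hfh : (-adjoint L) v ∈ subdiff (fun x => f x + h x) x := by
    simpa only [neg_add_rev, neg_add_cancel_right, neg_apply] using add_mem_subdiff_add hxv.1 hη
  have hsum := add_mem_subdiff_add (adjoint_mem_subdiff_comp (-adjoint L) (mem_subdiff_conj hfh))
    (mem_subdiff_conj hxv.2)
  rwa [map_neg, ContinuousLinearMap.adjoint_adjoint, neg_apply, neg_add_cancel] at hsum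

end OptimalityConditions

section WeakConvergence

variable {H K : Type*} [NormedAddCommGroup H] [InnerProductSpace ℝ H]
  [NormedAddCommGroup K] [InnerProductSpace ℝ K] {ι : Type*} {𝓁 : Filter ι}

theorem tendsto_toWeakSpace_iff [CompleteSpace H] {x : ι → H} {l : H} :
    Tendsto (fun i => toWeakSpace ℝ H (x i)) 𝓁 (𝓝 (toWeakSpace ℝ H l)) ↔
      ∀ y, Tendsto (fun i => inner ℝ (x i) y) 𝓁 (𝓝 (inner ℝ l y)) := by
  have hinj : Function.Injective (topDualPairing ℝ H).flip := fun a b hab =>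
    (SeparatingDual.eq_iff_forall_dual_eq (R := ℝ)).2 fun φ => LinearMap.congr_fun hab φ
  refine (WeakBilin.tendsto_iff_forall_eval_tendsto _ hinj).trans
    ((InnerProductSpace.toDual ℝ H).surjective.forall.trans (forall_congr' fun y => ?_))
  simp only [real_inner_comm y]
  rfl

theorem exists_tendsto_toWeakSpace_of_norm_le [CompleteSpace H] (𝒰 : Ultrafilter ι) {x : ι → H}
    {R : ℝ} (hx : ∀ i, ‖x i‖ ≤ R) :
    ∃ l, Tendsto (fun i => toWeakSpace ℝ H (x i)) 𝒰 (𝓝 (toWeakSpace ℝ H l)) := by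
  obtain ⟨φ, -, hφ⟩ := (WeakDual.isCompact_closedBall (𝕜 := ℝ) (E := H) 0 R).ultrafilter_le_nhds
    (𝒰.map fun i => StrongDual.toWeakDual (InnerProductSpace.toDual ℝ H (x i))) <| by
      refine le_principal_iff.2 (Ultrafilter.mem_map.2 (univ_mem' fun i => ?_))
      simpa only [mem_preimage, StrongDual.toStrongDual_toWeakDual, mem_closedBall_zero_iff,
        LinearIsometryEquiv.norm_map] using hx i
  refine ⟨(InnerProductSpace.toDual ℝ H).symm (WeakDual.toStrongDual φ),
    tendsto_toWeakSpace_iff.2 fun y => ?_⟩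
  rw [InnerProductSpace.toDual_symm_apply]
  exact ((WeakDual.eval_continuous y).tendsto φ).comp hφ

theorem weakTendsto_of_forall_ultrafilter [CompleteSpace H] {x : ℕ → H} {l : H} {R : ℝ}
    (hx : ∀ i, ‖x i‖ ≤ R)
    (h : ∀ 𝒰 : Ultrafilter ℕ, (𝒰 : Filter ℕ) ≤ atTop → ∀ l',
      Tendsto (fun i => toWeakSpace ℝ H (x i)) 𝒰 (𝓝 (toWeakSpace ℝ H l')) → l' = l) :
    WeakTendsto x l := by
  refine (tendsto_iff_ultrafilter _ _ _).2 fun 𝒰 h𝒰 => ?_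
  obtain ⟨l', hl'⟩ := exists_tendsto_toWeakSpace_of_norm_le 𝒰 hx
  exact h 𝒰 h𝒰 l' hl' ▸ hl'

theorem WeakTendsto.map {x : ℕ → H} {l : H} (hx : WeakTendsto x l) (T : H →L[ℝ] K) :
    WeakTendsto (fun i => T (x i)) (T l) :=
  ((WeakSpace.map T).continuous.tendsto _).comp hx

theorem weakTendsto_of_tendsto {x : ℕ → H} {l : H} (hx : Tendsto x atTop (𝓝 l)) :
    WeakTendsto x l :=
  ((toWeakSpaceCLM ℝ H).continuous.tendsto l).comp hx

theorem WeakTendsto.sub {x y : ℕ → H} {l m : H} (hx : WeakTendsto x l) (hy : WeakTendsto y m) :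
    WeakTendsto (fun i => x i - y i) (l - m) := by
  simpa only [WeakTendsto, map_sub] using Tendsto.sub hx hy

theorem WeakTendsto.congr_sub {x y : ℕ → H} {l : H} (hx : WeakTendsto x l)
    (hxy : Tendsto (fun i => y i - x i) atTop (𝓝 0)) : WeakTendsto y l := by
  simpa only [WeakTendsto, ← map_add, add_sub_cancel, add_zero] using
    Tendsto.add hx (weakTendsto_of_tendsto hxy)

theorem tendsto_inner_of_norm_le_of_tendsto_zero {x y : ι → H} {R : ℝ} (hx : ∀ i, ‖x i‖ ≤ R)
    (hy : Tendsto y 𝓁 (𝓝 0)) : Tendsto (fun i => inner ℝ (x i) (y i)) 𝓁 (𝓝 0) := by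
  refine squeeze_zero_norm (fun i => (norm_inner_le_norm _ _).trans
    (mul_le_mul_of_nonneg_right (hx i) (norm_nonneg _))) ?_
  simpa using hy.norm.const_mul R

theorem tendsto_zero_of_antitone_of_sum_mul_le {a e : ℕ → ℝ} {C : ℝ} (he : Antitone e)
    (he₀ : ∀ i, 0 ≤ e i) (ha : ∀ i, 0 ≤ a i) (hC : ∀ n, ∑ i ∈ Finset.range n, a i * e i ≤ C)
    (hsum : Tendsto (fun n => ∑ i ∈ Finset.range n, a i) atTop atTop) :
    Tendsto e atTop (𝓝 0) := by
  have hsmall : ∀ ε > 0, ∃ n, e n < ε := by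
    intro ε hε
    by_contra! hge
    obtain ⟨n, hn⟩ := (hsum.eventually_gt_atTop (C / ε)).exists
    refine (hC n).not_gt (((div_lt_iff₀ hε).1 hn).trans_le ?_)
    rw [Finset.sum_mul]
    exact Finset.sum_le_sum fun i _ => mul_le_mul_of_nonneg_left (hge i) (ha i)
  refine Metric.tendsto_atTop.2 fun ε hε => ?_
  obtain ⟨N, hN⟩ := hsmall ε hε
  refine ⟨N, fun n hn => ?_⟩
  rw [Real.dist_0_eq_abs, abs_of_nonneg (he₀ n)]
  exact (he hn).trans_lt hN

end WeakConvergence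

section MonotoneOperators

variable {Z : Type*} [NormedAddCommGroup Z] [InnerProductSpace ℝ Z] {P : Z →L[ℝ] Z}
  {A : Z → Set Z}

/-- The squared norm of `Z_P`, the space `Z` with the inner product `⟪x, P y⟫`. -/
def sqNorm (P : Z →L[ℝ] Z) (x : Z) : ℝ := inner ℝ x (P x)

theorem stronglyPositive_of_le_sqNorm [CompleteSpace Z] (hP : IsSelfAdjoint P) {a : ℝ}
    (ha : 0 < a) (h : ∀ x, a * ‖x‖ ^ 2 ≤ sqNorm P x) : StronglyPositive P := by
  have hPa : IsSelfAdjoint (P - a • ContinuousLinearMap.id ℝ Z) := hP.sub (.smul (.all a) (.one _))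
  refine ⟨a, ha, ContinuousLinearMap.isPositive_def'.2 ⟨hPa, fun x => ?_⟩⟩
  rw [ContinuousLinearMap.reApplyInnerSelf_apply, RCLike.re_to_real, real_inner_comm]
  simpa only [sqNorm, sub_apply, smul_apply, ContinuousLinearMap.id_apply, inner_sub_right,
    real_inner_smul_right, real_inner_self_eq_norm_sq, sub_nonneg] using h x

theorem sqNorm_smul (P : Z →L[ℝ] Z) (t : ℝ) (x : Z) : sqNorm P (t • x) = t ^ 2 * sqNorm P x := by
  rw [sqNorm, map_smul, real_inner_smul_left, real_inner_smul_right, sqNorm]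
  ring

namespace StronglyPositive

theorem inner_comm (hP : StronglyPositive P) (x y : Z) : inner ℝ x (P y) = inner ℝ y (P x) := by
  obtain ⟨a, -, h⟩ := hP
  have hxy := h.inner_left_eq_inner_right x y
  simp only [sub_apply, smul_apply, ContinuousLinearMap.id_apply, inner_sub_left, inner_sub_right,
    real_inner_smul_left, real_inner_smul_right, sub_left_inj] at hxy
  rw [← hxy, real_inner_comm]

theorem exists_mul_norm_sq_le (hP : StronglyPositive P) :
    ∃ a > 0, ∀ x, a * ‖x‖ ^ 2 ≤ sqNorm P x := by
  obtain ⟨a, ha, h⟩ := hP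
  refine ⟨a, ha, fun x => ?_⟩
  simpa only [sqNorm, sub_apply, smul_apply, ContinuousLinearMap.id_apply, inner_sub_right,
    real_inner_smul_right, real_inner_self_eq_norm_sq, sub_nonneg] using h.inner_nonneg_right x

theorem sqNorm_nonneg (hP : StronglyPositive P) (x : Z) : 0 ≤ sqNorm P x := by
  obtain ⟨a, ha, h⟩ := hP.exists_mul_norm_sq_le
  exact le_trans (by positivity) (h x)

theorem eq_zero_of_sqNorm_nonpos (hP : StronglyPositive P) {x : Z} (hx : sqNorm P x ≤ 0) :
    x = 0 := by
  obtain ⟨a, ha, h⟩ := hP.exists_mul_norm_sq_le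
  have hsq : ‖x‖ ^ 2 ≤ 0 := nonpos_of_mul_nonpos_right ((h x).trans hx) ha
  simpa using hsq

theorem surjective [CompleteSpace Z] (hP : StronglyPositive P) : Function.Surjective P := by
  obtain ⟨a, ha, h⟩ := hP.exists_mul_norm_sq_le
  have hcoercive : IsCoercive ((innerSL ℝ).comp P) := ⟨a, ha, fun x => by
    change a * ‖x‖ * ‖x‖ ≤ inner ℝ (P x) x
    rw [real_inner_comm, mul_assoc, ← sq]
    exact h x⟩
  have hLaxMilgram : ⇑hcoercive.continuousLinearEquivOfBilin = P :=
    funext fun x => ext_inner_right ℝ (hcoercive.continuousLinearEquivOfBilin_apply x)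
  exact hLaxMilgram ▸ hcoercive.continuousLinearEquivOfBilin.surjective

theorem exists_norm_le_of_sqNorm_le (hP : StronglyPositive P) (C : ℝ) :
    ∃ R, ∀ x, sqNorm P x ≤ C → ‖x‖ ≤ R := by
  obtain ⟨a, ha, h⟩ := hP.exists_mul_norm_sq_le
  exact ⟨√(C / a), fun x hx => Real.le_sqrt_of_sq_le ((le_div_iff₀' ha).2 ((h x).trans hx))⟩

theorem tendsto_zero_of_sqNorm (hP : StronglyPositive P) {ι : Type*} {𝓁 : Filter ι} {x : ι → Z}
    (hx : Tendsto (fun i => sqNorm P (x i)) 𝓁 (𝓝 0)) : Tendsto x 𝓁 (𝓝 0) := by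
  obtain ⟨a, ha, h⟩ := hP.exists_mul_norm_sq_le
  have hsq : Tendsto (fun i => ‖x i‖ ^ 2) 𝓁 (𝓝 0) :=
    squeeze_zero (fun i => sq_nonneg _) (fun i => (le_inv_mul_iff₀ ha).2 (h _))
      (by simpa only [mul_zero] using hx.const_mul a⁻¹)
  simpa [tendsto_zero_iff_norm_tendsto_zero] using hsq.sqrt

theorem sqNorm_add (hP : StronglyPositive P) (x y : Z) :
    sqNorm P (x + y) = sqNorm P x + 2 * inner ℝ x (P y) + sqNorm P y := by
  simp only [sqNorm, map_add, inner_add_left, inner_add_right, hP.inner_comm y x]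
  ring

theorem sqNorm_sub (hP : StronglyPositive P) (x y : Z) :
    sqNorm P (x - y) = sqNorm P x - 2 * inner ℝ x (P y) + sqNorm P y := by
  simp only [sqNorm, map_sub, inner_sub_left, inner_sub_right, hP.inner_comm y x]
  ring

theorem weak_limit_unique [CompleteSpace Z] (hP : StronglyPositive P) {r : ℕ → Z} {s s' : Z}
    {α β : ℝ} (hα : Tendsto (fun i => sqNorm P (r i - s)) atTop (𝓝 α))
    (hβ : Tendsto (fun i => sqNorm P (r i - s')) atTop (𝓝 β)) {𝒰 𝒱 : Ultrafilter ℕ}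
    (h𝒰 : (𝒰 : Filter ℕ) ≤ atTop) (h𝒱 : (𝒱 : Filter ℕ) ≤ atTop)
    (hs : Tendsto (fun i => toWeakSpace ℝ Z (r i)) 𝒰 (𝓝 (toWeakSpace ℝ Z s)))
    (hs' : Tendsto (fun i => toWeakSpace ℝ Z (r i)) 𝒱 (𝓝 (toWeakSpace ℝ Z s'))) : s' = s := by
  have hinner : Tendsto (fun i => inner ℝ (r i) (P (s' - s))) atTop
      (𝓝 ((α - β - (sqNorm P s - sqNorm P s')) / 2)) := by
    refine (((hα.sub hβ).sub_const _).div_const 2).congr fun i => ?_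
    rw [hP.sqNorm_sub, hP.sqNorm_sub, map_sub, inner_sub_right]
    ring
  have h𝒰s := tendsto_nhds_unique (hinner.mono_left h𝒰) (tendsto_toWeakSpace_iff.1 hs _)
  have h𝒱s := tendsto_nhds_unique (hinner.mono_left h𝒱) (tendsto_toWeakSpace_iff.1 hs' _)
  refine sub_eq_zero.1 (hP.eq_zero_of_sqNorm_nonpos ?_)
  rw [sqNorm, inner_sub_left, ← h𝒰s, ← h𝒱s, sub_self]

/-- Opial's lemma in `Z_P`. -/
theorem exists_weakTendsto_of_fejer [CompleteSpace Z] (hP : StronglyPositive P) {S : Set Z}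
    (hS : S.Nonempty) {r : ℕ → Z} (hr : ∀ s ∈ S, Antitone fun i => sqNorm P (r i - s))
    (hcluster : ∀ 𝒰 : Ultrafilter ℕ, (𝒰 : Filter ℕ) ≤ atTop → ∀ s,
      Tendsto (fun i => toWeakSpace ℝ Z (r i)) 𝒰 (𝓝 (toWeakSpace ℝ Z s)) → s ∈ S) :
    ∃ s ∈ S, WeakTendsto r s := by
  obtain ⟨s₀, hs₀⟩ := hS
  obtain ⟨R, hR⟩ := hP.exists_norm_le_of_sqNorm_le (sqNorm P (r 0 - s₀))
  have hbdd : ∀ i, ‖r i‖ ≤ R + ‖s₀‖ := fun i =>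
    (norm_le_norm_sub_add _ s₀).trans (add_le_add_left (hR _ (hr s₀ hs₀ i.zero_le)) _)
  have hlim : ∀ s ∈ S, Tendsto (fun i => sqNorm P (r i - s)) atTop
      (𝓝 (⨅ i, sqNorm P (r i - s))) := fun s hs =>
    tendsto_atTop_ciInf (hr s hs) ⟨0, forall_mem_range.2 fun i => hP.sqNorm_nonneg _⟩
  obtain ⟨𝒰, h𝒰⟩ := Ultrafilter.exists_le (atTop : Filter ℕ)
  obtain ⟨s, hs⟩ := exists_tendsto_toWeakSpace_of_norm_le 𝒰 hbdd
  have hsS := hcluster 𝒰 h𝒰 s hs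
  exact ⟨s, hsS, weakTendsto_of_forall_ultrafilter hbdd fun 𝒱 h𝒱 s' hs' =>
    hP.weak_limit_unique (hlim s hsS) (hlim s' (hcluster 𝒱 h𝒱 s' hs')) h𝒰 h𝒱 hs hs'⟩

end StronglyPositive

theorem mem_resolvent_iff {E : Type*} [NormedAddCommGroup E] {A : E → Set E} {r z : E} :
    z ∈ resolvent A r ↔ r - z ∈ A z := by
  simp [resolvent, opInv, sub_eq_add_neg]

theorem MonotoneIn.sqNorm_sub_le (hA : MonotoneIn P A) (hP : StronglyPositive P) {r z r' z' : Z}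
    (hz : r - z ∈ A z) (hz' : r' - z' ∈ A z') : sqNorm P (z - z') ≤ sqNorm P (r - r') := by
  have hmono := hA _ _ _ hz _ hz'
  have hsplit := hP.sqNorm_add (z - z') (r - z - (r' - z'))
  rw [show z - z' + (r - z - (r' - z')) = r - r' by abel] at hsplit
  linarith [hP.sqNorm_nonneg (r - z - (r' - z'))]

theorem MonotoneIn.resolvent_unique (hA : MonotoneIn P A) (hP : StronglyPositive P) {r z z' : Z}
    (hz : r - z ∈ A z) (hz' : r - z' ∈ A z') : z = z' := by
  refine sub_eq_zero.1 (hP.eq_zero_of_sqNorm_nonpos ((hA.sqNorm_sub_le hP hz hz').trans ?_))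
  rw [sqNorm, sub_self, inner_zero_left]

/-- The easy half of Minty's theorem. -/
theorem MonotoneIn.maxMonotoneIn (hA : MonotoneIn P A) (hP : StronglyPositive P)
    (hdom : ∀ r, (resolvent A r).Nonempty) : MaxMonotoneIn P A := by
  refine ⟨hA, fun B hB hAB => funext fun z => (subset_antisymm ?_ (hAB z))⟩
  intro v hv
  obtain ⟨z', hz'⟩ := hdom (z + v)
  rw [mem_resolvent_iff] at hz'
  obtain rfl : z = z' :=
    hB.resolvent_unique hP (r := z + v) (by rwa [add_sub_cancel_left]) (hAB _ hz')
  rwa [add_sub_cancel_left] at hz'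

theorem MaxMonotoneIn.mem_of_forall (hA : MaxMonotoneIn P A) {z a : Z}
    (h : ∀ x, ∀ v ∈ A x, 0 ≤ inner ℝ (x - z) (P (v - a))) : a ∈ A z := by
  suffices hext : (fun x => A x ∪ {v | x = z ∧ v = a}) = A by
    rw [← hext]
    exact Or.inr ⟨rfl, rfl⟩
  refine hA.2 _ ?_ fun x => subset_union_left
  rintro x y v (hv | ⟨rfl, rfl⟩) w (hw | ⟨rfl, rfl⟩)
  · exact hA.1 x y v hv w hw
  · exact h x v hv
  · rw [← neg_sub y, ← neg_sub w, map_neg, inner_neg_neg]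
    exact h y w hw
  · rw [sub_self, inner_zero_left]

end MonotoneOperators

section DouglasRachford

variable {Z : Type*} [NormedAddCommGroup Z] [InnerProductSpace ℝ Z] {P : Z →L[ℝ] Z}
  {A B : Z → Set Z}

/-- One Douglas–Rachford step at `r`: `z = J_A r` and `w = J_B (2 z - r)`. The step leaves `r` fixed
exactly when `w = z`, so `IsDRStep A B r z z` says that `r` is a fixed point, with
`0 ∈ A z + B z`. -/
structure IsDRStep (A B : Z → Set Z) (r z w : Z) : Prop where
  left : r - z ∈ A z
  right : (2 : ℝ) • z - r - w ∈ B w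

theorem isDRStep_self_iff {r z : Z} : IsDRStep A B r z z ↔ r - z ∈ A z ∧ z - r ∈ B z := by
  have hzr : (2 : ℝ) • z - r - z = z - r := by module
  exact ⟨fun h => ⟨h.left, hzr ▸ h.right⟩, fun h => ⟨h.1, hzr.symm ▸ h.2⟩⟩

theorem exists_isDRStep_self_iff {z : Z} : (∃ r, IsDRStep A B r z z) ↔ (0 : Z) ∈ A z + B z := by
  simp only [isDRStep_self_iff, Set.mem_add]
  constructor
  · rintro ⟨r, ha, hb⟩
    exact ⟨_, ha, _, hb, sub_add_sub_cancel' _ _ _ |>.trans (sub_self _)⟩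
  · rintro ⟨a, ha, b, hb, hab⟩
    obtain rfl := eq_neg_of_add_eq_zero_right hab
    exact ⟨z + a, by rwa [add_sub_cancel_left], by rwa [sub_add_cancel_left]⟩

/-- Firm nonexpansiveness of the map `r ↦ r + (w - z)`. -/
theorem IsDRStep.inner_le_neg_sqNorm {r z w r' z' w' : Z} (h : IsDRStep A B r z w)
    (h' : IsDRStep A B r' z' w') (hP : StronglyPositive P) (hA : MonotoneIn P A)
    (hB : MonotoneIn P B) :
    inner ℝ (r - r') (P (w - z - (w' - z'))) ≤ -sqNorm P (w - z - (w' - z')) := by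
  have hAmono := hA _ _ _ h.left _ h'.left
  have hBmono := hB _ _ _ h.right _ h'.right
  rw [show r - z - (r' - z') = r - r' - (z - z') by abel] at hAmono
  rw [show (2 : ℝ) • z - r - w - ((2 : ℝ) • z' - r' - w')
      = z - z' - (r - r') - (w - z - (w' - z')) by module,
    show w - w' = z - z' + (w - z - (w' - z')) by abel] at hBmono
  generalize r - r' = a at *
  generalize z - z' = b at *
  generalize w - z - (w' - z') = d at *
  simp only [map_sub, inner_sub_right, inner_add_left] at hAmono hBmono
  rw [sqNorm, hP.inner_comm a d]
  linarith [hP.inner_comm b d]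

theorem IsDRStep.sqNorm_add_smul_sub_le {r z w r' z' : Z} (h : IsDRStep A B r z w)
    (h' : IsDRStep A B r' z' z') (hP : StronglyPositive P) (hA : MonotoneIn P A)
    (hB : MonotoneIn P B) {ρ : ℝ} (hρ : 0 ≤ ρ) :
    sqNorm P (r + ρ • (w - z) - r') ≤
      sqNorm P (r - r') - ρ * (2 - ρ) * sqNorm P (w - z) := by
  have hfirm := h.inner_le_neg_sqNorm h' hP hA hB
  rw [sub_self, sub_zero] at hfirm
  rw [add_sub_right_comm, hP.sqNorm_add, sqNorm_smul, map_smul, real_inner_smul_right]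
  linarith [mul_le_mul_of_nonneg_left hfirm hρ]

theorem IsDRStep.sqNorm_sub_le_sqNorm_sub {r z w z' w' : Z} {ρ : ℝ} (h : IsDRStep A B r z w)
    (h' : IsDRStep A B (r + ρ • (w - z)) z' w') (hP : StronglyPositive P) (hA : MonotoneIn P A)
    (hB : MonotoneIn P B) (hρ : ρ ∈ Icc (0 : ℝ) 2) :
    sqNorm P (w' - z') ≤ sqNorm P (w - z) := by
  have hfirm := h'.inner_le_neg_sqNorm h hP hA hB
  rw [add_sub_cancel_left, real_inner_smul_left] at hfirm
  have hadd := hP.sqNorm_add (w - z) (w' - z' - (w - z))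
  rw [add_sub_cancel] at hadd
  have hnonneg := hP.sqNorm_nonneg (w' - z' - (w - z))
  rcases hρ.1.eq_or_lt with rfl | hρ₀
  · rw [zero_mul] at hfirm
    have hconst : w' - z' - (w - z) = 0 := hP.eq_zero_of_sqNorm_nonpos (by linarith)
    rw [sub_eq_zero.1 hconst]
  · have hmul := mul_nonneg (sub_nonneg.2 hρ.2) hnonneg
    have hcross : 2 * inner ℝ (w - z) (P (w' - z' - (w - z)))
        + sqNorm P (w' - z' - (w - z)) ≤ 0 :=
      nonpos_of_mul_nonpos_right (by linarith) hρ₀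
    linarith

theorem IsDRStep.inner_add_inner_add_inner_nonneg {r z w x v y u : Z} (h : IsDRStep A B r z w)
    (hP : StronglyPositive P) (hA : MonotoneIn P A) (hB : MonotoneIn P B) (hv : v ∈ A x)
    (hu : u ∈ B y) :
    0 ≤ inner ℝ (x - z) (P v) + inner ℝ (y - z) (P u) + inner ℝ (r - z) (P (y - x))
      + inner ℝ (y - u - r) (P (w - z)) := by
  have hAmono := hA _ _ _ h.left _ hv
  have hBmono := hB _ _ _ h.right _ hu
  have hd := hP.sqNorm_nonneg (w - z)
  rw [show (2 : ℝ) • z - r - w - u = z - r - u - (w - z) by module,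
    show w - y = z - y + (w - z) by abel] at hBmono
  generalize w - z = d at *
  rw [sqNorm] at hd
  simp only [map_sub, inner_sub_right, inner_sub_left, inner_add_left] at hAmono hBmono ⊢
  linarith [hP.inner_comm d z, hP.inner_comm d r, hP.inner_comm d u, hP.inner_comm y r,
    hP.inner_comm y z, hP.inner_comm x r, hP.inner_comm x z]

theorem inner_add_inner_nonneg_of_weak_limit [CompleteSpace Z] (hP : StronglyPositive P)
    (hA : MonotoneIn P A) (hB : MonotoneIn P B) {ι : Type*} {𝓁 : Filter ι} [𝓁.NeBot]
    {r z w : ι → Z} {r' z' x v y u : Z} {C : ℝ} (h : ∀ i, IsDRStep A B (r i) (z i) (w i))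
    (hrC : ∀ i, ‖r i‖ ≤ C) (hwz : Tendsto (fun i => w i - z i) 𝓁 (𝓝 0))
    (hr : Tendsto (fun i => toWeakSpace ℝ Z (r i)) 𝓁 (𝓝 (toWeakSpace ℝ Z r')))
    (hz : Tendsto (fun i => toWeakSpace ℝ Z (z i)) 𝓁 (𝓝 (toWeakSpace ℝ Z z')))
    (hv : v ∈ A x) (hu : u ∈ B y) :
    0 ≤ inner ℝ (x - z') (P (v - (r' - z'))) + inner ℝ (y - z') (P (u - (z' - r'))) := by
  rw [tendsto_toWeakSpace_iff] at hr hz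
  have hz_sub (a b : Z) : Tendsto (fun i => inner ℝ (a - z i) b) 𝓁 (𝓝 (inner ℝ (a - z') b)) := by
    simpa only [inner_sub_left] using (hz b).const_sub (inner ℝ a b)
  have hrz : Tendsto (fun i => inner ℝ (r i - z i) (P (y - x))) 𝓁
      (𝓝 (inner ℝ (r' - z') (P (y - x)))) := by
    simpa only [inner_sub_left] using (hr _).sub (hz _)
  have hd : Tendsto (fun i => inner ℝ (y - u - r i) (P (w i - z i))) 𝓁 (𝓝 0) :=
    tendsto_inner_of_norm_le_of_tendsto_zero
      (fun i => (norm_sub_le _ _).trans (add_le_add_right (hrC i) _))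
      (by simpa only [map_zero, Function.comp_def] using (P.continuous.tendsto 0).comp hwz)
  have hlim := ge_of_tendsto (((hz_sub x (P v)).add (hz_sub y (P u))).add hrz |>.add hd)
    (.of_forall fun i => (h i).inner_add_inner_add_inner_nonneg hP hA hB hv hu)
  refine hlim.trans_eq ?_
  have hcross := hP.inner_comm (r' - z') (y - x)
  rw [← neg_sub r' z', hcross]
  generalize r' - z' = e
  simp only [map_sub, map_neg, inner_sub_right, inner_sub_left, inner_neg_right]
  ring

/-- Demiclosedness of the Douglas–Rachford map. -/
theorem isDRStep_self_of_weak_limit [CompleteSpace Z] (hP : StronglyPositive P)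
    (hA : MaxMonotoneIn P A) (hB : MaxMonotoneIn P B) {ι : Type*} {𝓁 : Filter ι} [𝓁.NeBot]
    {r z w : ι → Z} {r' z' : Z} {C : ℝ} (h : ∀ i, IsDRStep A B (r i) (z i) (w i))
    (hrC : ∀ i, ‖r i‖ ≤ C) (hwz : Tendsto (fun i => w i - z i) 𝓁 (𝓝 0))
    (hr : Tendsto (fun i => toWeakSpace ℝ Z (r i)) 𝓁 (𝓝 (toWeakSpace ℝ Z r')))
    (hz : Tendsto (fun i => toWeakSpace ℝ Z (z i)) 𝓁 (𝓝 (toWeakSpace ℝ Z z'))) :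
    IsDRStep A B r' z' z' := by
  have hsum {x v y u : Z} (hv : v ∈ A x) (hu : u ∈ B y) :=
    inner_add_inner_nonneg_of_weak_limit hP hA.1 hB.1 h hrC hwz hr hz hv hu
  rw [isDRStep_self_iff]
  have hA' : r' - z' ∈ A z' := by
    -- A violation of monotonicity at `A` makes the other summand positive for all of `B`, so that
    -- `(z', z' - r')` lies in the graph of `B`, where that summand vanishes.
    refine hA.mem_of_forall fun x v hv => ?_
    by_contra! hneg
    have hB' : z' - r' ∈ B z' := hB.mem_of_forall fun y u hu => by linarith [hsum hv hu]
    have hv' := hsum hv hB'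
    rw [sub_self z', inner_zero_left, add_zero] at hv'
    exact hneg.not_ge hv'
  refine ⟨hA', hB.mem_of_forall fun y u hu => ?_⟩
  simpa only [sub_self, inner_zero_left, zero_add] using hsum hA' hu

namespace IsDouglasRachford

variable {ρ : ℕ → ℝ} {r z w : ℕ → Z} {r' z' : Z}

theorem isDRStep (h : IsDouglasRachford A B ρ r z w) (i : ℕ) : IsDRStep A B (r i) (z i) (w i) where
  left := mem_resolvent_iff.1 ((h.z_eq i).symm ▸ mem_singleton _)
  right := mem_resolvent_iff.1 ((h.w_eq i).symm ▸ mem_singleton _)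

theorem sqNorm_sub_succ_le (h : IsDouglasRachford A B ρ r z w) (hP : StronglyPositive P)
    (hA : MonotoneIn P A) (hB : MonotoneIn P B) (hρ : ∀ i, ρ i ∈ Icc (0 : ℝ) 2)
    (h' : IsDRStep A B r' z' z') (i : ℕ) :
    sqNorm P (r (i + 1) - r') ≤
      sqNorm P (r i - r') - ρ i * (2 - ρ i) * sqNorm P (w i - z i) :=
  h.s_succ i ▸ (h.isDRStep i).sqNorm_add_smul_sub_le h' hP hA hB (hρ i).1

theorem antitone_sqNorm_sub (h : IsDouglasRachford A B ρ r z w) (hP : StronglyPositive P)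
    (hA : MonotoneIn P A) (hB : MonotoneIn P B) (hρ : ∀ i, ρ i ∈ Icc (0 : ℝ) 2)
    (h' : IsDRStep A B r' z' z') : Antitone fun i => sqNorm P (r i - r') :=
  antitone_nat_of_succ_le fun i => (h.sqNorm_sub_succ_le hP hA hB hρ h' i).trans <|
    sub_le_self _ <| mul_nonneg (mul_nonneg (hρ i).1 (sub_nonneg.2 (hρ i).2)) (hP.sqNorm_nonneg _)

theorem tendsto_sub (h : IsDouglasRachford A B ρ r z w) (hP : StronglyPositive P)
    (hA : MonotoneIn P A) (hB : MonotoneIn P B) (hρ : ∀ i, ρ i ∈ Icc (0 : ℝ) 2)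
    (hρsum : Tendsto (fun n => ∑ i ∈ Finset.range n, ρ i * (2 - ρ i)) atTop atTop)
    (h' : IsDRStep A B r' z' z') : Tendsto (fun i => w i - z i) atTop (𝓝 0) := by
  have hanti : Antitone fun i => sqNorm P (w i - z i) := antitone_nat_of_succ_le fun i =>
    (h.isDRStep i).sqNorm_sub_le_sqNorm_sub (h.s_succ i ▸ h.isDRStep (i + 1)) hP hA hB (hρ i)
  have hsum (n : ℕ) : ∑ i ∈ Finset.range n, ρ i * (2 - ρ i) * sqNorm P (w i - z i) ≤
      sqNorm P (r 0 - r') :=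
    calc
      _ ≤ ∑ i ∈ Finset.range n, (sqNorm P (r i - r') - sqNorm P (r (i + 1) - r')) :=
        Finset.sum_le_sum fun i _ => le_sub_comm.1 (h.sqNorm_sub_succ_le hP hA hB hρ h' i)
      _ = sqNorm P (r 0 - r') - sqNorm P (r n - r') := Finset.sum_range_sub' _ n
      _ ≤ sqNorm P (r 0 - r') := sub_le_self _ (hP.sqNorm_nonneg _)
  exact hP.tendsto_zero_of_sqNorm <| tendsto_zero_of_antitone_of_sum_mul_le hanti
    (fun i => hP.sqNorm_nonneg _) (fun i => mul_nonneg (hρ i).1 (sub_nonneg.2 (hρ i).2)) hsum hρsum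

theorem weakTendsto [CompleteSpace Z] (h : IsDouglasRachford A B ρ r z w)
    (hP : StronglyPositive P) (hA : MaxMonotoneIn P A) (hB : MaxMonotoneIn P B)
    (hρ : ∀ i, ρ i ∈ Icc (0 : ℝ) 2)
    (hρsum : Tendsto (fun n => ∑ i ∈ Finset.range n, ρ i * (2 - ρ i)) atTop atTop)
    (hzero : ∃ z₀, (0 : Z) ∈ A z₀ + B z₀) :
    ∃ z', (0 : Z) ∈ A z' + B z' ∧ WeakTendsto z z' ∧ WeakTendsto w z' := by
  obtain ⟨z₀, hz₀⟩ := hzero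
  obtain ⟨r₀, h₀⟩ := exists_isDRStep_self_iff.2 hz₀
  have hanti {s t : Z} (hst : IsDRStep A B s t t) := h.antitone_sqNorm_sub hP hA.1 hB.1 hρ hst
  have hwz := h.tendsto_sub hP hA.1 hB.1 hρ hρsum h₀
  obtain ⟨R, hR⟩ := hP.exists_norm_le_of_sqNorm_le (sqNorm P (r 0 - r₀))
  have hrR : ∀ i, ‖r i‖ ≤ R + ‖r₀‖ := fun i =>
    (norm_le_norm_sub_add _ r₀).trans (add_le_add_left (hR _ (hanti h₀ i.zero_le)) _)
  have hzR : ∀ i, ‖z i‖ ≤ R + ‖z₀‖ := fun i =>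
    (norm_le_norm_sub_add _ z₀).trans <| add_le_add_left (hR _ <|
      (hA.1.sqNorm_sub_le hP (h.isDRStep i).left h₀.left).trans (hanti h₀ i.zero_le)) _
  have hdemi {𝒰 : Ultrafilter ℕ} (h𝒰 : (𝒰 : Filter ℕ) ≤ atTop) {s t : Z}
      (hs : Tendsto (fun i => toWeakSpace ℝ Z (r i)) 𝒰 (𝓝 (toWeakSpace ℝ Z s)))
      (ht : Tendsto (fun i => toWeakSpace ℝ Z (z i)) 𝒰 (𝓝 (toWeakSpace ℝ Z t))) :
      IsDRStep A B s t t :=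
    isDRStep_self_of_weak_limit hP hA hB h.isDRStep hrR (hwz.mono_left h𝒰) hs ht
  obtain ⟨r', ⟨z', h'⟩, hr'⟩ := hP.exists_weakTendsto_of_fejer
    (S := {s | ∃ t, IsDRStep A B s t t}) ⟨r₀, z₀, h₀⟩ (fun s ⟨t, hst⟩ => hanti hst)
    fun 𝒰 h𝒰 s hs => (exists_tendsto_toWeakSpace_of_norm_le 𝒰 hzR).imp fun t => hdemi h𝒰 hs
  have hz' : WeakTendsto z z' := weakTendsto_of_forall_ultrafilter hzR fun 𝒰 h𝒰 t ht =>
    hA.1.resolvent_unique hP (hdemi h𝒰 (hr'.mono_left h𝒰) ht).left h'.left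
  exact ⟨z', exists_isDRStep_self_iff.1 ⟨r', h'⟩, hz', hz'.congr_sub hwz⟩

end IsDouglasRachford

end DouglasRachford

section PrimalDual

theorem eq_toLp_iff {p : ENNReal} {α β : Type*} {z : WithLp p (α × β)} {x : α} {u : β} :
    z = WithLp.toLp p (x, u) ↔ z.fst = x ∧ z.snd = u :=
  ⟨by rintro rfl; exact ⟨rfl, rfl⟩, by rintro ⟨rfl, rfl⟩; rfl⟩

variable {X U : Type*} [NormedAddCommGroup X] [InnerProductSpace ℝ X] [CompleteSpace X]
  [NormedAddCommGroup U] [InnerProductSpace ℝ U] [CompleteSpace U]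
  {f : X → EReal} {g : U → EReal} {L : X →L[ℝ] U} {Q : X →L[ℝ] X} {c : X} {τ σ : ℝ}
  {z v : WithLp 2 (X × U)}

@[simp]
theorem precond_fst (L : X →L[ℝ] U) (Q : X →L[ℝ] X) (τ σ : ℝ) (z : WithLp 2 (X × U)) :
    (precond L Q τ σ z).fst = (1 / τ) • z.fst - (1 / 2 : ℝ) • Q z.fst := rfl

@[simp]
theorem precond_snd (L : X →L[ℝ] U) (Q : X →L[ℝ] X) (τ σ : ℝ) (z : WithLp 2 (X × U)) :
    (precond L Q τ σ z).snd = (1 / σ) • z.snd - τ • L (adjoint L z.snd) := rfl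

theorem inner_precond (L : X →L[ℝ] U) (Q : X →L[ℝ] X) (τ σ : ℝ) (z v : WithLp 2 (X × U)) :
    inner ℝ z (precond L Q τ σ v) =
      inner ℝ z.fst (precond L Q τ σ v).fst + inner ℝ z.snd (precond L Q τ σ v).snd :=
  WithLp.prod_inner_apply _ _

theorem isSelfAdjoint_precond (hQ : IsSelfAdjoint Q) (L : X →L[ℝ] U) (τ σ : ℝ) :
    IsSelfAdjoint (precond L Q τ σ) := by
  refine ContinuousLinearMap.isSelfAdjoint_iff_isSymmetric.2 fun x y => ?_
  have hxy := ContinuousLinearMap.isSelfAdjoint_iff_isSymmetric.1 hQ x.fst y.fst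
  rw [ContinuousLinearMap.coe_coe] at hxy
  rw [ContinuousLinearMap.coe_coe, real_inner_comm, inner_precond, inner_precond]
  simp only [precond_fst, precond_snd, inner_sub_right, real_inner_smul_right,
    ← ContinuousLinearMap.adjoint_inner_left L, ← hxy, real_inner_comm x.fst,
    real_inner_comm x.snd, real_inner_comm (Q x.fst), real_inner_comm (adjoint L x.snd)]

theorem sqNorm_precond (L : X →L[ℝ] U) (Q : X →L[ℝ] X) (τ σ : ℝ) (z : WithLp 2 (X × U)) :
    sqNorm (precond L Q τ σ) z =
      1 / τ * ‖z.fst‖ ^ 2 - 1 / 2 * inner ℝ z.fst (Q z.fst)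
        + (1 / σ * ‖z.snd‖ ^ 2 - τ * ‖adjoint L z.snd‖ ^ 2) := by
  simp only [sqNorm, inner_precond, precond_fst, precond_snd, inner_sub_right,
    real_inner_smul_right, ← ContinuousLinearMap.adjoint_inner_left L, real_inner_self_eq_norm_sq]

theorem stronglyPositive_precond (hQ : IsSelfAdjoint Q) (hτ : 0 < τ) (hσ : 0 < σ)
    (hτQ : τ * ‖Q‖ < 2) (hστ : σ * τ * ‖L‖ ^ 2 < 1) : StronglyPositive (precond L Q τ σ) := by
  have hfst : 0 < 1 / τ - ‖Q‖ / 2 := by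
    rw [sub_pos, div_lt_div_iff₀ two_pos hτ]
    linarith
  have hsnd : 0 < 1 / σ - τ * ‖L‖ ^ 2 := by
    rw [sub_pos, lt_div_iff₀ hσ]
    linarith
  refine stronglyPositive_of_le_sqNorm (isSelfAdjoint_precond hQ L τ σ) (lt_min hfst hsnd)
    fun z => ?_
  have hQz : inner ℝ z.fst (Q z.fst) ≤ ‖Q‖ * ‖z.fst‖ ^ 2 :=
    calc
      inner ℝ z.fst (Q z.fst) ≤ ‖z.fst‖ * ‖Q z.fst‖ := real_inner_le_norm _ _
      _ ≤ ‖z.fst‖ * (‖Q‖ * ‖z.fst‖) := by gcongr; exact Q.le_opNorm _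
      _ = ‖Q‖ * ‖z.fst‖ ^ 2 := by ring
  have hLz : ‖adjoint L z.snd‖ ^ 2 ≤ ‖L‖ ^ 2 * ‖z.snd‖ ^ 2 := by
    rw [← mul_pow, ← ContinuousLinearMap.adjoint.norm_map L]
    gcongr
    exact (adjoint L).le_opNorm _
  rw [sqNorm_precond, WithLp.prod_norm_sq_eq_of_L2, mul_add]
  refine add_le_add ?_ ?_
  · refine (mul_le_mul_of_nonneg_right (min_le_left _ _) (sq_nonneg _)).trans ?_
    linarith
  · refine (mul_le_mul_of_nonneg_right (min_le_right _ _) (sq_nonneg _)).trans ?_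
    linarith [mul_le_mul_of_nonneg_left hLz hτ.le]

theorem mem_opM_iff : v ∈ opM f L Q c τ σ z ↔
    (precond L Q τ σ v).fst - ((1 / 2 : ℝ) • Q z.fst + c) ∈ subdiff f z.fst ∧
      (precond L Q τ σ v).snd = 0 := by
  simp only [opM, mem_preimage, mem_ofPred_eq, add_singleton, image_add_right, sub_eq_add_neg]

theorem mem_opN_iff : v ∈ opN g L Q τ σ z ↔
    (precond L Q τ σ v).fst = (1 / 2 : ℝ) • Q z.fst + adjoint L z.snd ∧
      z.snd ∈ subdiff g ((precond L Q τ σ v).snd + L z.fst) := by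
  simp only [opN, mem_preimage, mem_ofPred_eq, singleton_add, image_add_left, neg_neg, opInv,
    add_comm (L z.fst)]

theorem monotoneIn_opM (hf : Gamma0 f) (hQ : Q.IsPositive) (L : X →L[ℝ] U) (c : X) (τ σ : ℝ) :
    MonotoneIn (precond L Q τ σ) (opM f L Q c τ σ) := by
  intro z z' v hv v' hv'
  obtain ⟨hξ, hv₀⟩ := mem_opM_iff.1 hv
  obtain ⟨hξ', hv₀'⟩ := mem_opM_iff.1 hv'
  have hmono := hf.inner_sub_nonneg hξ hξ'
  have hQmono := hQ.inner_nonneg_right (z.fst - z'.fst)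
  rw [map_sub] at hQmono
  rw [inner_precond, map_sub, WithLp.sub_fst, WithLp.sub_snd, WithLp.sub_snd, hv₀, hv₀', sub_zero,
    inner_zero_right, WithLp.sub_fst]
  generalize (precond L Q τ σ v).fst = p at *
  generalize (precond L Q τ σ v').fst = p' at *
  simp only [inner_sub_left, inner_sub_right, inner_add_right, real_inner_smul_right] at *
  linarith

theorem monotoneIn_opN (hg : Gamma0 g) (hQ : Q.IsPositive) (L : X →L[ℝ] U) (τ σ : ℝ) :
    MonotoneIn (precond L Q τ σ) (opN g L Q τ σ) := by
  intro z z' v hv v' hv'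
  obtain ⟨hv₁, hp⟩ := mem_opN_iff.1 hv
  obtain ⟨hv₁', hp'⟩ := mem_opN_iff.1 hv'
  have hmono := hg.inner_sub_nonneg hp hp'
  have hQmono := hQ.inner_nonneg_right (z.fst - z'.fst)
  rw [map_sub] at hQmono
  rw [inner_precond, map_sub, WithLp.sub_fst, WithLp.sub_snd, WithLp.sub_snd, WithLp.sub_fst, hv₁,
    hv₁']
  rw [real_inner_comm] at hmono
  generalize (precond L Q τ σ v).snd = p at *
  generalize (precond L Q τ σ v').snd = p' at *
  simp only [inner_sub_left, inner_sub_right, inner_add_right, real_inner_smul_right,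
    ContinuousLinearMap.adjoint_inner_right, map_sub, real_inner_comm z.snd,
    real_inner_comm z'.snd] at *
  linarith

theorem precond_snd_eq_zero_iff (hP : StronglyPositive (precond L Q τ σ)) :
    (precond L Q τ σ z).snd = 0 ↔ z.snd = 0 := by
  refine ⟨fun hz => ?_, fun hz => by simp [hz]⟩
  have hnorm : sqNorm (precond L Q τ σ) (WithLp.toLp 2 (0, z.snd)) =
      inner ℝ z.snd (precond L Q τ σ z).snd := by simp [sqNorm]
  rw [hz, inner_zero_right] at hnorm
  exact congrArg WithLp.snd (hP.eq_zero_of_sqNorm_nonpos hnorm.le)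

theorem resolvent_opM (hf : Gamma0 f) (hP : StronglyPositive (precond L Q τ σ)) (hτ : 0 < τ)
    (s : X) (u : U) :
    resolvent (opM f L Q c τ σ) (WithLp.toLp 2 (s, u)) =
      {WithLp.toLp 2 (prox (scale τ f) (s - (τ / 2) • Q s - τ • c), u)} := by
  ext z
  have hfst : (precond L Q τ σ (WithLp.toLp 2 (s, u) - z)).fst - ((1 / 2 : ℝ) • Q z.fst + c) =
      τ⁻¹ • (s - (τ / 2) • Q s - τ • c - z.fst) := by
    rw [precond_fst, WithLp.sub_fst, WithLp.toLp_fst, map_sub]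
    match_scalars <;> field_simp
    ring
  rw [mem_resolvent_iff, mem_opM_iff, precond_snd_eq_zero_iff hP, hfst,
    ← hf.prox_scale_eq_iff hτ, WithLp.sub_snd, sub_eq_zero, mem_singleton_iff, eq_toLp_iff,
    eq_comm (b := z.fst), eq_comm (b := z.snd)]
  exact Iff.rfl

theorem resolvent_opN (hg : Gamma0 g) (hτ : 0 < τ) (hσ : 0 < σ) {s y : X} {u v : U}
    (hv : v = prox (scale σ (conj g)) (u + σ • L (s - (τ / 2) • Q s - τ • adjoint L u)))
    (hy : y = s - (τ / 2) • Q s - τ • adjoint L v) :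
    resolvent (opN g L Q τ σ) (WithLp.toLp 2 (s, u)) = {WithLp.toLp 2 (y, v)} := by
  ext z
  have hfst : (precond L Q τ σ (WithLp.toLp 2 (s, u) - z)).fst =
        (1 / 2 : ℝ) • Q z.fst + adjoint L z.snd ↔
      z.fst = s - (τ / 2) • Q s - τ • adjoint L z.snd := by
    have hdiff : (precond L Q τ σ (WithLp.toLp 2 (s, u) - z)).fst
        - ((1 / 2 : ℝ) • Q z.fst + adjoint L z.snd) =
          τ⁻¹ • (s - (τ / 2) • Q s - τ • adjoint L z.snd - z.fst) := by
      rw [precond_fst, WithLp.sub_fst, WithLp.toLp_fst, map_sub]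
      match_scalars <;> field_simp
      ring
    rw [← sub_eq_zero, hdiff, smul_eq_zero_iff_right (inv_ne_zero hτ.ne'), sub_eq_zero, eq_comm]
  have hsnd (hz : z.fst = s - (τ / 2) • Q s - τ • adjoint L z.snd) :
      (precond L Q τ σ (WithLp.toLp 2 (s, u) - z)).snd + L z.fst =
        σ⁻¹ • (u + σ • L (s - (τ / 2) • Q s - τ • adjoint L u) - z.snd) := by
    rw [precond_snd, WithLp.sub_snd, WithLp.toLp_snd, hz]
    simp only [map_sub, map_smul]
    match_scalars <;> field_simp
    ring
  rw [mem_resolvent_iff, mem_opN_iff, hfst, mem_singleton_iff, eq_toLp_iff,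
    and_congr_right fun hz => by rw [hsnd hz, ← hg.prox_scale_conj_eq_iff hσ, ← hv],
    eq_comm (a := v)]
  exact and_congr_left fun hzv => by rw [hzv, ← hy]

theorem maxMonotoneIn_opM (hf : Gamma0 f) (hQ : Q.IsPositive)
    (hP : StronglyPositive (precond L Q τ σ)) (hτ : 0 < τ) (c : X) :
    MaxMonotoneIn (precond L Q τ σ) (opM f L Q c τ σ) :=
  (monotoneIn_opM hf hQ L c τ σ).maxMonotoneIn hP fun r =>
    ⟨_, (resolvent_opM hf hP hτ r.fst r.snd).superset rfl⟩

theorem maxMonotoneIn_opN (hg : Gamma0 g) (hQ : Q.IsPositive)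
    (hP : StronglyPositive (precond L Q τ σ)) (hτ : 0 < τ) (hσ : 0 < σ) :
    MaxMonotoneIn (precond L Q τ σ) (opN g L Q τ σ) :=
  (monotoneIn_opN hg hQ L τ σ).maxMonotoneIn hP fun r =>
    ⟨_, (resolvent_opN (s := r.fst) (u := r.snd) hg hτ hσ rfl rfl).superset rfl⟩

theorem zero_mem_opM_add_opN_iff (hP : StronglyPositive (precond L Q τ σ)) :
    0 ∈ opM f L Q c τ σ z + opN g L Q τ σ z ↔ IsKKT f g L (Q z.fst + c) z.fst z.snd := by
  have hsum : -((1 / 2 : ℝ) • Q z.fst + adjoint L z.snd) - ((1 / 2 : ℝ) • Q z.fst + c) =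
      -(Q z.fst + c + adjoint L z.snd) := by module
  constructor
  · rintro ⟨a, ha, b, hb, hab⟩
    obtain rfl := eq_neg_of_add_eq_zero_left hab
    obtain ⟨hb₁, hb₂⟩ := mem_opN_iff.1 hb
    obtain ⟨ha₁, ha₂⟩ := mem_opM_iff.1 ha
    rw [map_neg, WithLp.neg_fst, hb₁, hsum] at ha₁
    rw [map_neg, WithLp.neg_snd, neg_eq_zero] at ha₂
    rw [ha₂, zero_add] at hb₂
    exact ⟨ha₁, hb₂⟩
  · rintro ⟨hf', hg'⟩
    obtain ⟨b, hb⟩ := hP.surjective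
      (WithLp.toLp 2 ((1 / 2 : ℝ) • Q z.fst + adjoint L z.snd, 0))
    obtain ⟨hb₁, hb₂⟩ := eq_toLp_iff.1 hb
    refine ⟨-b, mem_opM_iff.2 ?_, b, mem_opN_iff.2 ?_, neg_add_cancel b⟩
    · rw [map_neg, WithLp.neg_fst, WithLp.neg_snd, hb₁, hb₂, hsum]
      exact ⟨hf', neg_zero⟩
    · rw [hb₁, hb₂, zero_add]
      exact ⟨rfl, hg'⟩

variable {ρ : ℕ → ℝ} {s₀ : X} {u₀ : U} {xh yh sh s : ℕ → X} {uh u : ℕ → U}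

theorem IsFormI.isDouglasRachford (h : IsFormI f g L Q c τ σ ρ s₀ u₀ xh uh sh s u)
    (hf : Gamma0 f) (hg : Gamma0 g) (hP : StronglyPositive (precond L Q τ σ)) (hτ : 0 < τ)
    (hσ : 0 < σ) :
    IsDouglasRachford (opM f L Q c τ σ) (opN g L Q τ σ) ρ
      (fun i => WithLp.toLp 2 (s i, u i)) (fun i => WithLp.toLp 2 (xh i, u i))
      (fun i => WithLp.toLp 2 (xh i + (sh i - s i), uh i)) where
  z_eq i := by rw [resolvent_opM hf hP hτ, ← h.xh_eq]
  w_eq i := by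
    have hy : xh i + (sh i - s i) = (2 : ℝ) • xh i - s i - (τ / 2) • Q ((2 : ℝ) • xh i - s i)
        - τ • adjoint L (uh i) := by
      rw [h.sh_eq]
      module
    rw [← WithLp.toLp_smul, ← WithLp.toLp_sub, Prod.smul_mk, Prod.mk_sub_mk, two_smul ℝ (u i),
      add_sub_cancel_right]
    exact resolvent_opN hg hτ hσ (h.uh_eq i) hy
  s_succ i := by
    rw [h.s_succ, h.u_succ, ← WithLp.toLp_sub, ← WithLp.toLp_smul, ← WithLp.toLp_add,
      Prod.mk_sub_mk, Prod.smul_mk, Prod.mk_add_mk, add_sub_cancel_left]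

theorem IsFormII.isDouglasRachford (h : IsFormII f g L Q c τ σ ρ s₀ u₀ uh yh xh s u)
    (hf : Gamma0 f) (hg : Gamma0 g) (hP : StronglyPositive (precond L Q τ σ)) (hτ : 0 < τ)
    (hσ : 0 < σ) :
    IsDouglasRachford (opN g L Q τ σ) (opM f L Q c τ σ) ρ
      (fun i => WithLp.toLp 2 (s i, u i)) (fun i => WithLp.toLp 2 (yh i, uh i))
      (fun i => WithLp.toLp 2 (xh i, (2 : ℝ) • uh i - u i)) where
  z_eq i := resolvent_opN hg hτ hσ (h.uh_eq i) (h.yh_eq i)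
  w_eq i := by
    rw [← WithLp.toLp_smul, ← WithLp.toLp_sub, Prod.smul_mk, Prod.mk_sub_mk,
      resolvent_opM hf hP hτ, ← h.xh_eq]
  s_succ i := by
    rw [h.s_succ, h.u_succ, ← WithLp.toLp_sub, ← WithLp.toLp_smul, ← WithLp.toLp_add,
      Prod.mk_sub_mk, Prod.smul_mk, Prod.mk_add_mk, two_smul, sub_right_comm,
      add_sub_cancel_right]

theorem IsFormI.weakTendsto (h : IsFormI f g L Q c τ σ ρ s₀ u₀ xh uh sh s u) (hf : Gamma0 f)
    (hg : Gamma0 g) (hQ : Q.IsPositive) (hP : StronglyPositive (precond L Q τ σ)) (hτ : 0 < τ)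
    (hσ : 0 < σ) (hρ : ∀ i, ρ i ∈ Icc (0 : ℝ) 2)
    (hρsum : Tendsto (fun n => ∑ i ∈ Finset.range n, ρ i * (2 - ρ i)) atTop atTop)
    (hsol : ∃ x v, IsKKT f g L (Q x + c) x v) :
    ∃ x' u', IsKKT f g L (Q x' + c) x' u' ∧ WeakTendsto xh x' ∧ WeakTendsto u u' := by
  obtain ⟨x, v, hxv⟩ := hsol
  obtain ⟨z, hz, hzlim, -⟩ := (h.isDouglasRachford hf hg hP hτ hσ).weakTendsto hP
    (maxMonotoneIn_opM hf hQ hP hτ c) (maxMonotoneIn_opN hg hQ hP hτ hσ) hρ hρsum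
    ⟨WithLp.toLp 2 (x, v), (zero_mem_opM_add_opN_iff hP).2 hxv⟩
  exact ⟨z.fst, z.snd, (zero_mem_opM_add_opN_iff hP).1 hz, hzlim.map (WithLp.fstL 2 ℝ X U),
    hzlim.map (WithLp.sndL 2 ℝ X U)⟩

theorem IsFormII.weakTendsto (h : IsFormII f g L Q c τ σ ρ s₀ u₀ uh yh xh s u) (hf : Gamma0 f)
    (hg : Gamma0 g) (hQ : Q.IsPositive) (hP : StronglyPositive (precond L Q τ σ)) (hτ : 0 < τ)
    (hσ : 0 < σ) (hρ : ∀ i, ρ i ∈ Icc (0 : ℝ) 2)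
    (hρsum : Tendsto (fun n => ∑ i ∈ Finset.range n, ρ i * (2 - ρ i)) atTop atTop)
    (hsol : ∃ x v, IsKKT f g L (Q x + c) x v) :
    ∃ x' u', IsKKT f g L (Q x' + c) x' u' ∧ WeakTendsto xh x' ∧ WeakTendsto u u' := by
  obtain ⟨x, v, hxv⟩ := hsol
  obtain ⟨z, hz, hzlim, hwlim⟩ := (h.isDouglasRachford hf hg hP hτ hσ).weakTendsto hP
    (maxMonotoneIn_opN hg hQ hP hτ hσ) (maxMonotoneIn_opM hf hQ hP hτ c) hρ hρsum
    ⟨WithLp.toLp 2 (x, v), add_comm (opM f L Q c τ σ _) _ ▸ (zero_mem_opM_add_opN_iff hP).2 hxv⟩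
  rw [add_comm, zero_mem_opM_add_opN_iff hP] at hz
  have huh : WeakTendsto uh z.snd := hzlim.map (WithLp.sndL 2 ℝ X U)
  have hreflect : WeakTendsto (fun i => (2 : ℝ) • uh i - u i) z.snd :=
    hwlim.map (WithLp.sndL 2 ℝ X U)
  refine ⟨z.fst, z.snd, hz, hwlim.map (WithLp.fstL 2 ℝ X U), ?_⟩
  convert huh.sub (hreflect.sub huh) using 2
  · module
  · rw [sub_self, sub_zero]

end PrimalDual

end PDDR

theorem theorem7p4 {X U : Type*}
    [NormedAddCommGroup X] [InnerProductSpace ℝ X] [CompleteSpace X]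
    [NormedAddCommGroup U] [InnerProductSpace ℝ U] [CompleteSpace U]
    (f : X → EReal) (hf : PDDR.Gamma0 f) (g : U → EReal) (hg : PDDR.Gamma0 g)
    (L : X →L[ℝ] U) (Q : X →L[ℝ] X) (hQ : Q.IsPositive) (hQ0 : Q ≠ 0) (c : X)
    -- the primal monotone inclusion has a solution
    (hsol : ∃ x : X, (0 : X) ∈ PDDR.subdiff f x
      + ContinuousLinearMap.adjoint L '' PDDR.subdiff g (L x) + {Q x + c})
    (τ σ : ℝ) (hτ : 0 < τ) (hτQ : τ < 2 / ‖Q‖) (hσ : 0 < σ) (hστ : σ * τ * ‖L‖ ^ 2 < 1)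
    (ρ : ℕ → ℝ) (hρ : ∀ i, ρ i ∈ Set.Icc (0 : ℝ) 2)
    (hρsum : Tendsto (fun n => ∑ i ∈ Finset.range n, ρ i * (2 - ρ i)) atTop atTop)
    (s₀ : X) (u₀ : U) :
    -- form I: convergence
    (∀ (xh : ℕ → X) (uh : ℕ → U) (sh s : ℕ → X) (u : ℕ → U),
      PDDR.IsFormI f g L Q c τ σ ρ s₀ u₀ xh uh sh s u →
        ∃ (x' : X) (u' : U),
          PDDR.IsPrimalSol f g L (PDDR.quad Q c) x' ∧ PDDR.IsDualSol f g L (PDDR.quad Q c) u' ∧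
          PDDR.WeakTendsto xh x' ∧ PDDR.WeakTendsto u u') ∧
    -- form II: convergence
    (∀ (uh : ℕ → U) (yh xh s : ℕ → X) (u : ℕ → U),
      PDDR.IsFormII f g L Q c τ σ ρ s₀ u₀ uh yh xh s u →
        ∃ (x' : X) (u' : U),
          PDDR.IsPrimalSol f g L (PDDR.quad Q c) x' ∧ PDDR.IsDualSol f g L (PDDR.quad Q c) u' ∧
          PDDR.WeakTendsto xh x' ∧ PDDR.WeakTendsto u u') ∧
    -- `P` defines the Hilbert space `Z_P`, in which `M` and `N` are maximally monotone
    IsSelfAdjoint (PDDR.precond L Q τ σ) ∧ PDDR.StronglyPositive (PDDR.precond L Q τ σ) ∧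
    PDDR.MaxMonotoneIn (PDDR.precond L Q τ σ) (PDDR.opM f L Q c τ σ) ∧
    PDDR.MaxMonotoneIn (PDDR.precond L Q τ σ) (PDDR.opN g L Q τ σ) ∧
    -- form I is the Douglas–Rachford iteration for `M`, `N`
    (∀ (xh : ℕ → X) (uh : ℕ → U) (sh s : ℕ → X) (u : ℕ → U),
      PDDR.IsFormI f g L Q c τ σ ρ s₀ u₀ xh uh sh s u →
        PDDR.IsDouglasRachford (PDDR.opM f L Q c τ σ) (PDDR.opN g L Q τ σ) ρ
          (fun i => WithLp.toLp 2 (s i, u i)) (fun i => WithLp.toLp 2 (xh i, u i))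
          (fun i => WithLp.toLp 2 (xh i + (sh i - s i), uh i))) ∧
    -- form II is the Douglas–Rachford iteration for `N`, `M`
    (∀ (uh : ℕ → U) (yh xh s : ℕ → X) (u : ℕ → U),
      PDDR.IsFormII f g L Q c τ σ ρ s₀ u₀ uh yh xh s u →
        PDDR.IsDouglasRachford (PDDR.opN g L Q τ σ) (PDDR.opM f L Q c τ σ) ρ
          (fun i => WithLp.toLp 2 (s i, u i)) (fun i => WithLp.toLp 2 (yh i, uh i))
          (fun i => WithLp.toLp 2 (xh i, (2 : ℝ) • uh i - u i))) := by
  have hτQ' : τ * ‖Q‖ < 2 := (lt_div_iff₀ (norm_pos_iff.2 hQ0)).1 hτQ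
  have hP : PDDR.StronglyPositive (PDDR.precond L Q τ σ) :=
    PDDR.stronglyPositive_precond hQ.isSelfAdjoint hτ hσ hτQ' hστ
  have hKKT : ∃ x v, PDDR.IsKKT f g L (Q x + c) x v := hsol.imp fun x hx => PDDR.exists_isKKT hx
  have hquad := PDDR.gradient_mem_subdiff_quad hQ c
  refine ⟨fun xh uh sh s u h => ?_, fun uh yh xh s u h => ?_,
    PDDR.isSelfAdjoint_precond hQ.isSelfAdjoint L τ σ, hP, PDDR.maxMonotoneIn_opM hf hQ hP hτ c,
    PDDR.maxMonotoneIn_opN hg hQ hP hτ hσ, fun xh uh sh s u h => h.isDouglasRachford hf hg hP hτ hσ,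
    fun uh yh xh s u h => h.isDouglasRachford hf hg hP hτ hσ⟩
  · obtain ⟨x', u', hxu, hx', hu'⟩ := h.weakTendsto hf hg hQ hP hτ hσ hρ hρsum hKKT
    exact ⟨x', u', hxu.isPrimalSol (hquad x'), hxu.isDualSol (hquad x'), hx', hu'⟩
  · obtain ⟨x', u', hxu, hx', hu'⟩ := h.weakTendsto hf hg hQ hP hτ hσ hρ hρsum hKKT
    exact ⟨x', u', hxu.isPrimalSol (hquad x'), hxu.isDualSol (hquad x'), hx', hu'⟩
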